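/- Let $\Gamma$ be a finitely generated discrete group with a fixed finite generating set, let $\Gamma_1\ge\Gamma_2\ge\cdots$ be a decreasing sequence of finite index normal subgroups with $\bigcap_n\Gamma_n=\{e\}$, and let $X_n=\Gamma/\Gamma_n$ carry the Cayley graph structure given by the image of the generating set. Let $X=\bigsqcup_n X_n$ be an associated box space, i.e. $X$ carries a metric of bounded geometry (for each $R>0$ the balls of radius $R$ have uniformly bounded cardinality) that restricts to the edge metric on each $X_n$ and satisfies $d(X_n,X\setminus X_n)\to\infty$. Then the following are equivalent: 1. $\Gamma$ is amenable (for every finite $K\subseteq\Gamma$ and $\epsilon>0$ there is a non-empty finite $F\subseteq\Gamma$ with $|kF\,\triangle\,F|<\epsilon|F|$ for all $k\in K$); 2. $X$ has all of the properties $A$, $ULA$, $ULA_\mu$, $MSP$, $ONL$; 3. $X$ has at least one of the properties $A$, $ULA$, $ULA_\mu$, $MSP$, $ONL$. Here, with $N_R(E)=\{y: d(y,E)\le R\}$ and $\partial_RE=N_R(E)\setminus E$: * $A$: for all $R,\epsilon>0$ there are $S>0$ and a map $x\mapsto\xi_x$ from $X$ to the probability measures on $X$ such that $\|\xi_x-\xi_y\|_{\ell^1}<\epsilon$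 whenever $d(x,y)\le R$, and each $\xi_x$ is supported in the closed ball $B(x;S)$. * $ULA$: for all $R,\epsilon>0$ there is $S>0$ such that for every non-empty finite $F\subseteq X$ there is a finite $E\subseteq X$ with $\mathrm{diam}(E)\le S$ and $|\partial_RE\cap F|<\epsilon|E\cap F|$. * $ULA_\mu$: for all $R,\epsilon>0$ there is $S>0$ such that for every probability measure $\mu$ on $X$ there is a finite $E\subseteq X$ with $\mathrm{diam}(E)\le S$ and $\mu(\partial_RE)<\epsilon\mu(E)$. * $MSP$: there is $c>0$ such that for all $R>0$ there is $S>0$ such that for every probability measure $\mu$ on $X$ there is a subset $\Omega=\bigsqcup_i\Omega_i$ of $X$ with $\mu(\Omega)\ge c$, $\mathrm{diam}(\Omega_i)\le S$ for all $i$, and $d(\Omega_i,\Omega_j)>R$ for all $i\ne j$. * $ONL$: there is $c>0$ such that for all $R>0$ there is $S>0$ such that for every probability measure $\mu$ on $X$, every non-zero separable complex Hilbert space $\mathcal H$, and every bounded operator $T=(T_{x,y})$ on $\ell^2(X,\mu,\mathcal H)$ (with norm $\|\phi\|^2=\sum_x\mu(x)\|\phi(x)\|^2$) with $T_{x,y}=0$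 whenever $d(x,y)>R$, there is a unit vector $\phi\in\ell^2(X,\mu,\mathcal H)$ with $\mathrm{diam}(\mathrm{supp}(\phi))\le S$ and $\|T\phi\|\ge c\|T\|$. -/

import Mathlib

open Filter MeasureTheory
open scoped Pointwise ENNReal symmDiff

noncomputable section

namespace BoxSpaces

/-! ### Coarse properties of a metric space

Closed `R`-neighbourhoods `N_R(E)` are `Metric.cthickening R E`, diameters are taken in `[0, ∞]`
(`Metric.ediam`), and probability measures on a discrete space are `PMF`s. -/

section Metric

variable (X : Type*) [MetricSpace X]

/-- The balls of a given radius have uniformly bounded cardinality. -/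
def BoundedGeometry : Prop :=
  ∀ R : ℝ, 0 < R → ∃ n : ℕ, ∀ x : X, (Metric.closedBall x R).encard ≤ n

variable {X} in
/-- The boundary `∂_R E = N_R(E) \ E`. -/
def boundary (R : ℝ) (E : Set X) : Set X := Metric.cthickening R E \ E

/-- Uniform local amenability (for non-empty finite sets `F`). -/
def ULA : Prop :=
  ∀ R ε : ℝ, 0 < R → 0 < ε → ∃ S : ℝ, 0 < S ∧
    ∀ F : Set X, F.Finite → F.Nonempty →
      ∃ E : Set X, E.Finite ∧ Metric.ediam E ≤ ENNReal.ofReal S ∧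
        ((boundary R E ∩ F).ncard : ℝ) < ε * ((E ∩ F).ncard : ℝ)

/-- Uniform local amenability with respect to probability measures. -/
def ULAmu : Prop :=
  ∀ R ε : ℝ, 0 < R → 0 < ε → ∃ S : ℝ, 0 < S ∧
    ∀ μ : PMF X, ∃ E : Set X, E.Finite ∧ Metric.ediam E ≤ ENNReal.ofReal S ∧
      μ.toOuterMeasure (boundary R E) < ENNReal.ofReal ε * μ.toOuterMeasure E

/-- Property A. -/
def PropertyA : Prop :=
  ∀ R ε : ℝ, 0 < R → 0 < ε → ∃ S : ℝ, 0 < S ∧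
    ∃ ξ : X → PMF X,
      (∀ x y : X, dist x y ≤ R → ∑' z : X, |(ξ x z).toReal - (ξ y z).toReal| < ε) ∧
      ∀ x : X, (ξ x).support ⊆ Metric.closedBall x S

/-- The metric sparsification property; `P` is the collection of the pieces of the
decomposition, and `⋃₀ P` is the set that is decomposed. -/
def MSP : Prop :=
  ∃ c : ℝ, 0 < c ∧ ∀ R : ℝ, 0 < R → ∃ S : ℝ, 0 < S ∧
    ∀ μ : PMF X, ∃ P : Set (Set X),
      P.PairwiseDisjoint id ∧
      ENNReal.ofReal c ≤ μ.toOuterMeasure (⋃₀ P) ∧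
      (∀ A ∈ P, Metric.ediam A ≤ ENNReal.ofReal S) ∧
      ∀ A ∈ P, ∀ B ∈ P, A ≠ B → ENNReal.ofReal R < ⨅ a ∈ A, ⨅ b ∈ B, edist a b

end Metric

section ONL

variable {X : Type*}

/-- The measure on all subsets of `X` given by a probability mass function. -/
abbrev discreteMeasure (μ : PMF X) : @Measure X ⊤ := @PMF.toMeasure X ⊤ μ

/-- The Hilbert space `l²(X, μ, H)` of functions `φ : X → H` with `∑ μ(x) ‖φ(x)‖² < ∞`,
modulo the functions of norm zero. -/
abbrev WeightedL2 (μ : PMF X) (H : Type*) [NormedAddCommGroup H] : Type _ :=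
  @Lp X H ⊤ _ 2 (discreteMeasure μ)

/-- The class in `l²(X, μ, H)` of the function with value `v` at `y` and `0` elsewhere. -/
def single {H : Type*} [NormedAddCommGroup H] (μ : PMF X) (y : X) (v : H) : WeightedL2 μ H :=
  letI : MeasurableSpace X := ⊤
  indicatorConstLp 2 (s := {y}) (μ := μ.toMeasure) trivial (measure_ne_top _ _) v

/-- The support of a class in `l²(X, μ, H)`; points of mass zero do not count, and at the
other points the value of the class does not depend on the representative. -/
def supp {H : Type*} [NormedAddCommGroup H] {μ : PMF X} (φ : WeightedL2 μ H) : Set X :=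
  {x | x ∈ μ.support ∧ φ x ≠ 0}

/-- The matrix entries `T_{x,y}`, that is `v ↦ T(single y v)(x)`, vanish whenever `d(x,y) > R`. -/
def HasPropagation [MetricSpace X] {H : Type*} [NormedAddCommGroup H] [InnerProductSpace ℂ H]
    {μ : PMF X} (R : ℝ) (T : WeightedL2 μ H →L[ℂ] WeightedL2 μ H) : Prop :=
  ∀ x ∈ μ.support, ∀ y ∈ μ.support, R < dist x y → ∀ v : H, T (single μ y v) x = 0

variable (X) in
/-- The operator norm localisation property. Every separable Hilbert space is isometrically
isomorphic to one in `Type`; the zero space, which has no unit vectors, is left out. -/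
def ONL [MetricSpace X] : Prop :=
  ∃ c : ℝ, 0 < c ∧ ∀ R : ℝ, 0 < R → ∃ S : ℝ, 0 < S ∧
    ∀ (μ : PMF X) (H : Type) [NormedAddCommGroup H] [InnerProductSpace ℂ H] [CompleteSpace H]
      [TopologicalSpace.SeparableSpace H] [Nontrivial H]
      (T : WeightedL2 μ H →L[ℂ] WeightedL2 μ H), HasPropagation R T →
      ∃ φ : WeightedL2 μ H, ‖φ‖ = 1 ∧ Metric.ediam (supp φ) ≤ ENNReal.ofReal S ∧
        c * ‖T‖ ≤ ‖T φ‖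

end ONL

/-! ### Groups and box spaces -/

/-- Amenability of a discrete group: existence of (left) Følner sets. -/
def IsAmenable (Γ : Type*) [Group Γ] : Prop :=
  ∀ (K : Set Γ) (ε : ℝ), K.Finite → 0 < ε →
    ∃ F : Set Γ, F.Finite ∧ F.Nonempty ∧ ∀ k ∈ K, (((k • F) ∆ F).ncard : ℝ) < ε * (F.ncard : ℝ)

/-- The Cayley graph: distinct `x`, `y` are joined iff `y = x s` or `x = y s` with `s ∈ S`. -/
def cayleyGraph {G : Type*} [Group G] (S : Set G) : SimpleGraph G :=
  SimpleGraph.fromRel fun x y => ∃ s ∈ S, y = x * s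

/-- The given metric on `⊔ V n` turns it into a space of graphs for the finite connected graphs
`G n`: it has bounded geometry, restricts to the edge metric on every `V n`, and the distance
from `V n` to its complement tends to infinity. -/
structure IsSpaceOfGraphs {V : ℕ → Type*} [MetricSpace (Σ n, V n)]
    (G : ∀ n, SimpleGraph (V n)) : Prop where
  finite : ∀ n, Finite (V n)
  connected : ∀ n, (G n).Connected
  boundedGeometry : BoundedGeometry (Σ n, V n)
  dist_eq : ∀ (n : ℕ) (x y : V n),
    dist (⟨n, x⟩ : Σ n, V n) ⟨n, y⟩ = ((G n).dist x y : ℝ)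
  separated : ∀ R : ℝ, ∀ᶠ n in atTop,
    ∀ (x : V n) (y : Σ n, V n), y.1 ≠ n → R ≤ dist (⟨n, x⟩ : Σ n, V n) y

/-- The given metric on `⊔ Γ/Γ_n` turns it into a box space of `Γ` with respect to the subgroups
`Γ_n = N n` and the finite generating set `S`. -/
structure IsBoxSpace {Γ : Type*} [Group Γ] (S : Finset Γ) (N : ℕ → Subgroup Γ)
    [∀ n, (N n).Normal] [MetricSpace (Σ n, Γ ⧸ N n)] : Prop where
  generates : Subgroup.closure (S : Set Γ) = ⊤
  antitone : Antitone N
  finiteIndex : ∀ n, (N n).FiniteIndex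
  iInf_eq_bot : ⨅ n, N n = ⊥
  isSpaceOfGraphs : IsSpaceOfGraphs (V := fun n => Γ ⧸ N n)
    fun n => cayleyGraph ((QuotientGroup.mk : Γ → Γ ⧸ N n) '' (S : Set Γ))

end BoxSpaces

end

/-! For a countable space of bounded geometry, A implies `ULAmu`, `ULAmu` implies `ULA`, `ULAmu` and
`MSP` imply each other, and `MSP` implies `ONL`; no group is involved. The group enters because
every finite subset of Γ embeds in all sufficiently late quotients, so that bounded pieces of far
components look like pieces of Γ.

Amenability gives A by translating one Følner set F: `ξ x` is uniform on xF. Conversely,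
`IsBoxSpace.isAmenable` lifts Følner sets of bounded diameter from a late quotient to Γ, and it
remains to find such sets. `ULA`, tested on a whole component, yields them directly.

`ONL` yields them by a spectral argument. The average T of the right translations by K ∪ {1} fixes
constants, so ‖T^m‖ ≥ 1 for every m, and `ONL` gives a unit vector φ of small support with ‖T^m φ‖ ≥
c, where c does not depend on m. If q < 1 and q^m < c, then some iterate ψ = T^j φ has ‖Tψ‖ ≥ q‖ψ‖.
By convexity of the Hilbert norm ψ is almost invariant, and a superlevel set of |ψ|² is a Følner
set. Passing to powers of T is what makes an arbitrary constant c sufficient. -/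

noncomputable section

namespace BoxSpaces

/-! ### Layer cake principle -/

section LayerCake

/-- A layer cake argument: an inequality between weighted sums of `a i - b i` and of `f j` is
inherited by the superlevel sets at some level `t ≥ 0`. -/
theorem exists_level_lt {ι κ : Type*} [Countable ι] [Countable κ] (w : ι → ℝ≥0∞) (a b : ι → ℝ)
    (v : κ → ℝ≥0∞) (f : κ → ℝ)
    (h : ∑' i, w i * ENNReal.ofReal (a i - b i) < ∑' j, v j * ENNReal.ofReal (f j)) :
    ∃ t : ℝ, 0 ≤ t ∧ ∑' i, w i * (Set.Ico (b i) (a i)).indicator 1 t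
      < ∑' j, v j * (Set.Ico 0 (f j)).indicator 1 t := by
  by_contra! hcon
  have hcon' : ∀ t : ℝ, ∑' j, v j * (Set.Ico 0 (f j)).indicator 1 t
      ≤ ∑' i, w i * (Set.Ico (b i) (a i)).indicator 1 t := by
    intro t
    by_cases ht : 0 ≤ t
    · exact hcon t ht
    · have : ∑' j, v j * (Set.Ico 0 (f j)).indicator 1 t = 0 := by
        refine ENNReal.tsum_eq_zero.2 fun j => ?_
        rw [Set.indicator_of_notMem (fun hm => ht hm.1), mul_zero]
      rw [this]
      exact zero_le
  have hmeas : ∀ c d : ℝ, Measurable ((Set.Ico c d).indicator (1 : ℝ → ℝ≥0∞)) := fun c d =>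
    measurable_one.indicator measurableSet_Ico
  -- Integrating over t turns the indicator of [b, a) into the positive part of a - b, which
  -- reverses the assumed inequality.
  have key := lintegral_mono (μ := volume) hcon'
  rw [lintegral_tsum fun j => ((hmeas _ _).const_mul _).aemeasurable,
    lintegral_tsum fun j => ((hmeas _ _).const_mul _).aemeasurable] at key
  simp only [lintegral_const_mul _ (hmeas _ _), lintegral_indicator_one measurableSet_Ico,
    Real.volume_Ico, sub_zero] at key
  exact absurd h (not_lt.2 key)

end LayerCake

/-! ### Property A implies uniform local amenability -/

section Coarse

variable {X : Type*} [MetricSpace X]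

theorem BoundedGeometry.finite_of_ediam_le (hX : BoundedGeometry X) {E : Set X} {S : ℝ}
    (hE : Metric.ediam E ≤ ENNReal.ofReal S) : E.Finite := by
  rcases E.eq_empty_or_nonempty with rfl | ⟨x, hx⟩
  · exact Set.finite_empty
  obtain ⟨n, hn⟩ := hX (max S 1) (by positivity)
  refine (Set.finite_of_encard_le_coe (hn x)).subset fun y hy => ?_
  have h := (Metric.edist_le_ediam_of_mem hy hx).trans hE
  have h' : edist y x ≤ ENNReal.ofReal (max S 1) :=
    h.trans (ENNReal.ofReal_le_ofReal (le_max_left _ _))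
  rwa [edist_le_ofReal (by positivity)] at h'

theorem tsum_indicator_one {α : Type*} (A : Set α) :
    ∑' x, A.indicator (1 : α → ℝ≥0∞) x = A.encard := by
  rw [← ENNReal.tsum_set_one, ← tsum_subtype]
  rfl

/-- For fixed z consider the function x ↦ `ξ x z`. Summed over z, these functions have μ-weighted
total mass 1 and small variation along pairs at distance ≤ R, so one z has variation less than ε
times its mass. A superlevel set of that function is the required set; it lies in the S-ball about
z. -/
theorem PropertyA.ulaMu [Countable X] (hX : BoundedGeometry X) (hA : PropertyA X) : ULAmu X := by
  intro R ε hR hε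
  obtain ⟨n, hn⟩ := hX R hR
  -- Each point has at most n neighbours within R, so the total variation is at most nε/(n+1),
  -- strictly below ε.
  obtain ⟨S, hS, ξ, hξ, hsupp⟩ := hA R (ε / (n + 1)) hR (by positivity)
  refine ⟨2 * S, by positivity, fun μ => ?_⟩
  set f : X → X → ℝ := fun z x => (ξ x z).toReal with hf
  set w : X × X → ℝ≥0∞ := fun p => μ p.1 * (Metric.closedBall p.1 R).indicator 1 p.2 with hw
  have hsum : ∀ x, Summable fun z => f z x := fun x =>
    ENNReal.summable_toReal ((ξ x).tsum_coe_ne_top)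
  have hdiff : ∀ x y, dist x y ≤ R →
      ∑' z, ENNReal.ofReal (f z y - f z x) ≤ ENNReal.ofReal (ε / (n + 1)) := by
    intro x y hxy
    have hs : Summable fun z => |f z x - f z y| := ((hsum x).sub (hsum y)).abs
    calc ∑' z, ENNReal.ofReal (f z y - f z x)
        ≤ ∑' z, ENNReal.ofReal |f z x - f z y| := ENNReal.tsum_le_tsum fun z =>
          ENNReal.ofReal_le_ofReal (by rw [abs_sub_comm]; exact le_abs_self _)
      _ = ENNReal.ofReal (∑' z, |f z x - f z y|) :=
          (ENNReal.ofReal_tsum_of_nonneg (fun _ => abs_nonneg _) hs).symm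
      _ ≤ _ := ENNReal.ofReal_le_ofReal (hξ x y hxy).le
  have hball : ∀ x, ∑' y, (Metric.closedBall x R).indicator (1 : X → ℝ≥0∞) y ≤ n := by
    intro x
    rw [tsum_indicator_one]
    exact_mod_cast hn x
  have hleft : ∑' z, ∑' p : X × X, w p * ENNReal.ofReal (f z p.2 - f z p.1)
      ≤ n * ENNReal.ofReal (ε / (n + 1)) := by
    rw [ENNReal.tsum_comm]
    calc ∑' p : X × X, ∑' z, w p * ENNReal.ofReal (f z p.2 - f z p.1)
        ≤ ∑' p : X × X, w p * ENNReal.ofReal (ε / (n + 1)) := by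
          refine ENNReal.tsum_le_tsum fun p => ?_
          rw [ENNReal.tsum_mul_left]
          by_cases hp : p.2 ∈ Metric.closedBall p.1 R
          · gcongr
            exact hdiff _ _ (by rw [dist_comm]; exact hp)
          · simp [hw, Set.indicator_of_notMem hp]
      _ = (∑' x, μ x * ∑' y, (Metric.closedBall x R).indicator (1 : X → ℝ≥0∞) y)
            * ENNReal.ofReal (ε / (n + 1)) := by
          rw [ENNReal.tsum_mul_right, ENNReal.tsum_prod']
          simp only [hw, ENNReal.tsum_mul_left]
      _ ≤ (∑' x, μ x * n) * ENNReal.ofReal (ε / (n + 1)) := by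
          gcongr with x
          exact hball x
      _ = n * ENNReal.ofReal (ε / (n + 1)) := by
          rw [ENNReal.tsum_mul_right, μ.tsum_coe, one_mul]
  have hright : ∑' z, ∑' x, (ENNReal.ofReal ε * μ x) * ENNReal.ofReal (f z x)
      = ENNReal.ofReal ε := by
    rw [ENNReal.tsum_comm]
    have : ∀ x z, ENNReal.ofReal (f z x) = ξ x z := fun x z =>
      ENNReal.ofReal_toReal ((ξ x).apply_ne_top z)
    simp only [this, ENNReal.tsum_mul_left, PMF.tsum_coe, mul_one]
  obtain ⟨z, hz⟩ : ∃ z, ∑' p : X × X, w p * ENNReal.ofReal (f z p.2 - f z p.1)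
      < ∑' x, (ENNReal.ofReal ε * μ x) * ENNReal.ofReal (f z x) := by
    by_contra! hcon
    have h1 := (hright.symm.le.trans (ENNReal.tsum_le_tsum hcon)).trans hleft
    rw [← ENNReal.ofReal_natCast, ← ENNReal.ofReal_mul (by positivity),
      ENNReal.ofReal_le_ofReal_iff (by positivity)] at h1
    have h2 : (n : ℝ) * (ε / (n + 1)) = ε - ε / (n + 1) := by field_simp; ring
    have h3 : 0 < ε / ((n : ℝ) + 1) := by positivity
    linarith
  obtain ⟨t, ht, hlt⟩ := exists_level_lt w (fun p => f z p.2) (fun p => f z p.1) _ _ hz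
  set E : Set X := {x | t < f z x} with hE
  have hEball : ∀ x ∈ E, dist z x ≤ S := by
    intro x hx
    have h0 : ξ x z ≠ 0 := by
      intro h0
      have : f z x = 0 := by simp [hf, h0]
      rw [hE, Set.mem_ofPred_eq, this] at hx
      linarith
    exact hsupp x ((PMF.mem_support_iff _ _).2 h0)
  have hdiam : Metric.ediam E ≤ ENNReal.ofReal (2 * S) := by
    refine Metric.ediam_le fun x hx y hy => ?_
    rw [edist_le_ofReal (by positivity)]
    have := dist_triangle_left x y z
    linarith [hEball x hx, hEball y hy]
  have hfin := hX.finite_of_ediam_le hdiam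
  refine ⟨E, hfin, hdiam, ?_⟩
  calc μ.toOuterMeasure (boundary R E)
      ≤ ∑' p : X × X, w p * (Set.Ico (f z p.1) (f z p.2)).indicator 1 t := by
        rw [PMF.toOuterMeasure_apply, ENNReal.tsum_prod']
        refine ENNReal.tsum_le_tsum fun x => ?_
        by_cases hx : x ∈ boundary R E
        · obtain ⟨hx1, hx2⟩ := hx
          -- E is finite, so a boundary point x has a y in E at distance ≤ R, and the pair (x, y)
          -- alone contributes the mass of x.
          rw [hfin.isCompact.cthickening_eq_biUnion_closedBall hR.le] at hx1
          simp only [Set.mem_iUnion, exists_prop] at hx1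
          obtain ⟨y, hy, hxy⟩ := hx1
          refine le_trans ?_ (ENNReal.le_tsum y)
          have h1 : y ∈ Metric.closedBall x R := Metric.mem_closedBall_comm.1 hxy
          have h2 : t ∈ Set.Ico (f z x) (f z y) := ⟨not_lt.1 hx2, hy⟩
          simp only [hw]
          rw [Set.indicator_of_mem h1, Set.indicator_of_mem h2]
          simpa using Set.indicator_le_self _ _ _
        · rw [Set.indicator_of_notMem hx]
          exact zero_le
    _ < _ := hlt
    _ = ENNReal.ofReal ε * μ.toOuterMeasure E := by
        rw [PMF.toOuterMeasure_apply, ← ENNReal.tsum_mul_left]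
        refine tsum_congr fun x => ?_
        by_cases hx : x ∈ E
        · rw [Set.indicator_of_mem hx, Set.indicator_of_mem (show t ∈ Set.Ico 0 (f z x) from ⟨ht, hx⟩)]
          simp
        · rw [Set.indicator_of_notMem hx, Set.indicator_of_notMem fun h => hx h.2]
          simp

theorem ULAmu.ula (h : ULAmu X) : ULA X := by
  classical
  intro R ε hR hε
  obtain ⟨S, hS, hS'⟩ := h R ε hR hε
  refine ⟨S, hS, fun F hF hne => ?_⟩
  have hne' : hF.toFinset.Nonempty := by simpa using hne
  obtain ⟨E, hE, hd, hlt⟩ := hS' (PMF.uniformOfFinset hF.toFinset hne')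
  refine ⟨E, hE, hd, ?_⟩
  have hcard : ∀ A : Set X, (PMF.uniformOfFinset hF.toFinset hne').toOuterMeasure A
      = ENNReal.ofReal (((A ∩ F).ncard : ℝ) / hF.toFinset.card) := by
    intro A
    rw [PMF.toOuterMeasure_uniformOfFinset_apply,
      ENNReal.ofReal_div_of_pos (by exact_mod_cast hne'.card_pos), ENNReal.ofReal_natCast,
      ENNReal.ofReal_natCast, ← Set.ncard_coe_finset]
    congr 3
    ext x
    simp [and_comm]
  rw [hcard, hcard, ← ENNReal.ofReal_mul hε.le,
    ENNReal.ofReal_lt_ofReal_iff_of_nonneg (by positivity), ← mul_div_assoc] at hlt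
  exact (div_lt_div_iff_of_pos_right (by exact_mod_cast hne'.card_pos)).1 hlt

end Coarse

/-! ### Metric sparsification and `ULAmu` -/

section Sparsification

theorem toOuterMeasure_union {X : Type*} (μ : PMF X) {s t : Set X} (h : Disjoint s t) :
    μ.toOuterMeasure (s ∪ t) = μ.toOuterMeasure s + μ.toOuterMeasure t := by
  simp only [PMF.toOuterMeasure_apply, ← ENNReal.tsum_add, Set.indicator_union_of_disjoint h]

theorem toOuterMeasure_filter {X : Type*} (μ : PMF X) (Z : Set X) (h : ∃ a ∈ Z, a ∈ μ.support)
    (A : Set X) : (μ.filter Z h).toOuterMeasure A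
      = μ.toOuterMeasure (A ∩ Z) * (μ.toOuterMeasure Z)⁻¹ := by
  simp only [PMF.toOuterMeasure_apply, ← ENNReal.tsum_mul_right]
  refine tsum_congr fun x => ?_
  by_cases hx : x ∈ A
  · rw [Set.indicator_of_mem hx, PMF.filter_apply]
    congr 1
    by_cases hz : x ∈ Z <;> simp [hx, hz]
  · rw [Set.indicator_of_notMem hx, Set.indicator_of_notMem fun h => hx h.1, zero_mul]

theorem toOuterMeasure_ne_top {X : Type*} (μ : PMF X) (s : Set X) : μ.toOuterMeasure s ≠ ∞ := by
  refine ne_top_of_le_ne_top μ.tsum_coe_ne_top ?_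
  rw [PMF.toOuterMeasure_apply]
  exact ENNReal.tsum_le_tsum fun x => Set.indicator_le_self _ _ _

theorem tsum_toOuterMeasure_le {X : Type*} (μ : PMF X) {ι : Type*} (A : ι → Set X)
    (h : Pairwise fun i j => Disjoint (A i) (A j)) : ∑' i, μ.toOuterMeasure (A i) ≤ 1 := by
  simp only [PMF.toOuterMeasure_apply]
  rw [ENNReal.tsum_comm, ← μ.tsum_coe]
  refine ENNReal.tsum_le_tsum fun x => ?_
  by_cases hx : ∃ i, x ∈ A i
  · obtain ⟨i, hi⟩ := hx
    rw [tsum_eq_single i]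
    · exact Set.indicator_le_self _ _ _
    · intro j hj
      exact Set.indicator_of_notMem (fun hxj => Set.disjoint_left.1 (h hj) hxj hi) _
  · have : ∀ i, (A i).indicator μ x = 0 := fun i =>
      Set.indicator_of_notMem (fun hi => hx ⟨i, hi⟩) _
    simp [this]

variable {X : Type*} [MetricSpace X]

/-- Greedy exhaustion: for μ conditioned on Z, find E whose collar weighs less than E, keep E ∩ Z,
discard the collar and recurse on the rest of Z. The discarded mass is at most the kept mass, whence
the factor 2. The collar has width R + 1 to make the separation strictly larger than R. -/
theorem ULAmu.exists_sparse_subset {R S : ℝ} (hR : 0 < R) (μ : PMF X)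
    (h : ∀ μ : PMF X, ∃ E : Set X, E.Finite ∧ Metric.ediam E ≤ ENNReal.ofReal S ∧
      μ.toOuterMeasure (boundary (R + 1) E) < ENNReal.ofReal 1 * μ.toOuterMeasure E)
    (Z : Finset X) :
    ∃ P : Set (Set X), (∀ A ∈ P, A ⊆ Z) ∧
      μ.toOuterMeasure Z ≤ 2 * μ.toOuterMeasure (⋃₀ P) ∧
      (∀ A ∈ P, Metric.ediam A ≤ ENNReal.ofReal S) ∧
      ∀ A ∈ P, ∀ B ∈ P, A ≠ B → ENNReal.ofReal R < ⨅ a ∈ A, ⨅ b ∈ B, edist a b := by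
  classical
  induction Z using Finset.strongInduction with
  | H Z ih =>
  by_cases hZ : ∃ a ∈ (Z : Set X), a ∈ μ.support
  swap
  · refine ⟨∅, by simp, ?_, by simp, by simp⟩
    have : μ.toOuterMeasure Z = 0 := by
      rw [PMF.toOuterMeasure_apply_eq_zero_iff, Set.disjoint_left]
      exact fun a ha haZ => hZ ⟨a, haZ, ha⟩
    simp [this]
  obtain ⟨E, -, hEd, hE⟩ := h (μ.filter Z hZ)
  have hZ0 : μ.toOuterMeasure Z ≠ 0 := by
    rw [Ne, PMF.toOuterMeasure_apply_eq_zero_iff, Set.disjoint_left]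
    obtain ⟨a, ha, ha'⟩ := hZ
    exact fun hd => hd ha' ha
  have hZt := toOuterMeasure_ne_top μ (Z : Set X)
  rw [ENNReal.ofReal_one, one_mul, toOuterMeasure_filter, toOuterMeasure_filter,
    ENNReal.mul_lt_mul_iff_left (ENNReal.inv_ne_zero.2 hZt) (ENNReal.inv_ne_top.2 hZ0)] at hE
  set N := Metric.cthickening (R + 1) E with hN
  have hEN : E ⊆ N := Metric.self_subset_cthickening E
  set Z' : Finset X := Z.filter (· ∉ N) with hZ'
  have hssub : Z' ⊂ Z := by
    refine Finset.filter_ssubset.2 ?_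
    -- If no point of Z is removed, then E misses Z and the inequality for E reads "something < 0".
    by_contra! hcon
    have : E ∩ Z = ∅ := by
      ext x
      simp only [Set.mem_inter_iff, Set.mem_empty_iff_false, iff_false]
      exact fun hx => hcon x hx.2 (hEN hx.1)
    rw [this] at hE
    simp at hE
  obtain ⟨P, hPZ, hPμ, hPd, hPs⟩ := ih Z' hssub
  have hfar : ∀ a ∈ E ∩ Z, ∀ b ∈ (Z' : Set X), ENNReal.ofReal (R + 1) ≤ edist a b := by
    intro a ha b hb
    have hb' : b ∉ N := (Finset.mem_filter.1 hb).2
    rw [hN, Metric.mem_cthickening_iff, not_le] at hb'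
    rw [edist_comm]
    exact hb'.le.trans (Metric.infEDist_le_edist_of_mem ha.1)
  have hlt : ENNReal.ofReal R < ENNReal.ofReal (R + 1) :=
    (ENNReal.ofReal_lt_ofReal_iff (by positivity)).2 (by linarith)
  have hsub : ⋃₀ P ⊆ (Z' : Set X) := Set.sUnion_subset hPZ
  refine ⟨insert (E ∩ Z) P, ?_, ?_, ?_, ?_⟩
  · rintro A (rfl | hA)
    · exact Set.inter_subset_right
    · exact (hPZ A hA).trans (by exact_mod_cast hssub.1)
  · have hdisj : Disjoint (E ∩ Z) (⋃₀ P) := by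
      rw [Set.disjoint_left]
      intro x hx hxP
      exact (Finset.mem_filter.1 (hsub hxP)).2 (hEN hx.1)
    rw [Set.sUnion_insert, toOuterMeasure_union μ hdisj]
    have hcover : (Z : Set X) ⊆ (E ∩ Z) ∪ ((boundary (R + 1) E ∩ Z) ∪ Z') := by
      intro x hx
      by_cases h1 : x ∈ E
      · exact Or.inl ⟨h1, hx⟩
      by_cases h2 : x ∈ N
      · exact Or.inr (Or.inl ⟨⟨h2, h1⟩, hx⟩)
      · exact Or.inr (Or.inr (Finset.mem_coe.2 (Finset.mem_filter.2 ⟨hx, h2⟩)))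
    calc μ.toOuterMeasure Z
        ≤ μ.toOuterMeasure (E ∩ Z) +
          (μ.toOuterMeasure (boundary (R + 1) E ∩ Z) + μ.toOuterMeasure Z') :=
          (measure_mono hcover).trans ((measure_union_le _ _).trans
            (add_le_add le_rfl (measure_union_le _ _)))
      _ ≤ μ.toOuterMeasure (E ∩ Z) +
          (μ.toOuterMeasure (E ∩ Z) + 2 * μ.toOuterMeasure (⋃₀ P)) := by gcongr
      _ = _ := by ring
  · rintro A (rfl | hA)
    · exact (Metric.ediam_mono Set.inter_subset_left).trans hEd
    · exact hPd A hA
  · rintro A (rfl | hA) B (rfl | hB) hAB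
    · exact absurd rfl hAB
    · exact hlt.trans_le (le_iInf₂ fun a ha => le_iInf₂ fun b hb => hfar a ha b (hPZ B hB hb))
    · refine hlt.trans_le (le_iInf₂ fun a ha => le_iInf₂ fun b hb => ?_)
      rw [edist_comm]
      exact hfar b hb a (hPZ A hA ha)
    · exact hPs A hA B hB hAB

theorem ULAmu.msp (h : ULAmu X) : MSP X := by
  refine ⟨1 / 4, by norm_num, fun R hR => ?_⟩
  obtain ⟨S, hS, hS'⟩ := h (R + 1) 1 (by positivity) one_pos
  refine ⟨S, hS, fun μ => ?_⟩
  -- The exhaustion needs a finite set: one of mass above 1/2 is taken, half of which survives,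
  -- giving 1/4.
  obtain ⟨Z, hZ⟩ : ∃ Z : Finset X, (2 : ℝ≥0∞)⁻¹ < ∑ x ∈ Z, μ x := by
    have h1 : (2 : ℝ≥0∞)⁻¹ < ∑' x, μ x := by
      rw [μ.tsum_coe]
      exact ENNReal.inv_lt_one.2 ENNReal.one_lt_two
    rw [ENNReal.tsum_eq_iSup_sum] at h1
    exact lt_iSup_iff.1 h1
  obtain ⟨P, -, hPμ, hPd, hPs⟩ := ULAmu.exists_sparse_subset hR μ hS' Z
  refine ⟨P, ?_, ?_, hPd, hPs⟩
  · intro A hA B hB hAB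
    refine Set.disjoint_left.2 fun x hxA hxB => ?_
    have h1 : ⨅ a ∈ A, ⨅ b ∈ B, edist a b ≤ edist x x :=
      (iInf₂_le x hxA).trans (iInf₂_le x hxB)
    rw [edist_self] at h1
    exact absurd (hPs A hA B hB hAB) (not_lt.2 (h1.trans zero_le))
  · rw [PMF.toOuterMeasure_apply_finset] at hPμ
    have h2 := hZ.le.trans hPμ
    have h4 : ENNReal.ofReal (1 / 4) = 2⁻¹ * 2⁻¹ := by
      rw [show (1 / 4 : ℝ) = 2⁻¹ * 2⁻¹ by norm_num, ENNReal.ofReal_mul (by norm_num),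
        ENNReal.ofReal_inv_of_pos two_pos]
      simp
    rw [h4]
    calc (2 : ℝ≥0∞)⁻¹ * 2⁻¹ ≤ 2⁻¹ * (2 * μ.toOuterMeasure (⋃₀ P)) := by gcongr
      _ = μ.toOuterMeasure (⋃₀ P) := by
        rw [← mul_assoc, ENNReal.inv_mul_cancel two_ne_zero ENNReal.ofNat_ne_top, one_mul]

theorem disjoint_cthickening {A B : Set X} {r R : ℝ} (hr : 0 ≤ r) (hR : 2 * r < R)
    (h : ENNReal.ofReal R < ⨅ a ∈ A, ⨅ b ∈ B, edist a b) :
    Disjoint (Metric.cthickening r A) (Metric.cthickening r B) := by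
  refine Set.disjoint_left.2 fun x hxA hxB => ?_
  rw [Metric.mem_cthickening_iff] at hxA hxB
  have hlt : ENNReal.ofReal r < ENNReal.ofReal (R / 2) :=
    (ENNReal.ofReal_lt_ofReal_iff (by linarith)).2 (by linarith)
  obtain ⟨a, ha, hxa⟩ := Metric.infEDist_lt_iff.1 (hxA.trans_lt hlt)
  obtain ⟨b, hb, hxb⟩ := Metric.infEDist_lt_iff.1 (hxB.trans_lt hlt)
  have h1 : edist a b ≤ ENNReal.ofReal R := by
    calc edist a b ≤ edist x a + edist x b := edist_triangle_left _ _ _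
      _ ≤ ENNReal.ofReal (R / 2) + ENNReal.ofReal (R / 2) := add_le_add hxa.le hxb.le
      _ = ENNReal.ofReal R := by
        rw [← ENNReal.ofReal_add (by linarith) (by linarith), add_halves]
  exact absurd (h.trans_le ((iInf₂_le a ha).trans (iInf₂_le b hb))) (not_lt.2 h1)

theorem ediam_cthickening_le_ofReal {A : Set X} {r S : ℝ} (hr : 0 ≤ r) (hS : 0 ≤ S)
    (h : Metric.ediam A ≤ ENNReal.ofReal S) :
    Metric.ediam (Metric.cthickening r A) ≤ ENNReal.ofReal (S + 2 * r) := by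
  lift r to NNReal using hr
  refine (Metric.ediam_cthickening_le r).trans ?_
  rw [ENNReal.ofReal_add hS (by positivity), ENNReal.ofReal_mul zero_le_two,
    ENNReal.ofReal_ofNat, ENNReal.ofReal_coe_nnreal]
  gcongr

theorem toOuterMeasure_sUnion_le {X : Type*} (μ : PMF X) (P : Set (Set X)) :
    μ.toOuterMeasure (⋃₀ P) ≤ ∑' A : P, μ.toOuterMeasure A := by
  simp only [PMF.toOuterMeasure_apply]
  rw [ENNReal.tsum_comm]
  refine ENNReal.tsum_le_tsum fun x => ?_
  by_cases hx : x ∈ ⋃₀ P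
  · obtain ⟨A, hA, hxA⟩ := id hx
    refine le_trans ?_ (ENNReal.le_tsum ⟨A, hA⟩)
    rw [Set.indicator_of_mem hx, Set.indicator_of_mem hxA]
  · rw [Set.indicator_of_notMem hx]
    exact zero_le

/-- If every bounded set had a collar of relative mass at least ε, then m successive thickenings by
R would multiply the mass of each piece by at least 1 + mε. Widely separated pieces stay disjoint
meanwhile, so (1 + mε)c ≤ 1, which the choice of m excludes. -/
theorem MSP.ulaMu (hX : BoundedGeometry X) (h : MSP X) : ULAmu X := by
  obtain ⟨c, hc, h⟩ := h
  intro R ε hR hε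
  obtain ⟨m, hm⟩ := exists_nat_gt (1 / (ε * c))
  obtain ⟨S, hS, h⟩ := h (2 * (m * R) + 1) (by positivity)
  refine ⟨S + 2 * (m * R), by positivity, fun μ => ?_⟩
  obtain ⟨P, -, hPμ, hPd, hPs⟩ := h μ
  by_contra! hcon
  have hgrow : ∀ A ∈ P, ∀ k ≤ m, (1 + k * ENNReal.ofReal ε) * μ.toOuterMeasure A
      ≤ μ.toOuterMeasure (Metric.cthickening (k * R) A) := by
    intro A hA k
    induction k with
    | zero =>
      intro _
      simpa using measure_mono (μ := μ.toOuterMeasure) (subset_closure (s := A))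
    | succ k ih =>
      intro hk
      have ih := ih (by omega)
      set E := Metric.cthickening (k * R) A with hE
      have hd : Metric.ediam E ≤ ENNReal.ofReal (S + 2 * (m * R)) := by
        refine (ediam_cthickening_le_ofReal (by positivity) hS.le (hPd A hA)).trans
          (ENNReal.ofReal_le_ofReal ?_)
        have : (k : ℝ) ≤ m := by exact_mod_cast (by omega : k ≤ m)
        gcongr
      have hb := hcon E (hX.finite_of_ediam_le hd) hd
      have hsub : E ∪ boundary R E ⊆ Metric.cthickening ((k + 1 : ℕ) * R) A := by
        have h1 : Metric.cthickening R E ⊆ Metric.cthickening ((k + 1 : ℕ) * R) A := by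
          have := Metric.cthickening_cthickening_subset hR.le
            (by positivity : 0 ≤ (k : ℝ) * R) A
          rwa [show R + k * R = ((k + 1 : ℕ) : ℝ) * R by push_cast; ring] at this
        exact Set.union_subset ((Metric.self_subset_cthickening E).trans h1)
          (Set.sdiff_subset.trans h1)
      calc (1 + ((k + 1 : ℕ) : ℝ≥0∞) * ENNReal.ofReal ε) * μ.toOuterMeasure A
          = (1 + k * ENNReal.ofReal ε) * μ.toOuterMeasure A
            + ENNReal.ofReal ε * μ.toOuterMeasure A := by push_cast; ring
        _ ≤ μ.toOuterMeasure E + ENNReal.ofReal ε * μ.toOuterMeasure E := by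
            gcongr
            exact Metric.self_subset_cthickening A
        _ ≤ μ.toOuterMeasure E + μ.toOuterMeasure (boundary R E) := by gcongr
        _ = μ.toOuterMeasure (E ∪ boundary R E) :=
            (toOuterMeasure_union μ Set.disjoint_sdiff_right).symm
        _ ≤ _ := measure_mono hsub
  have hle : (1 + m * ENNReal.ofReal ε) * ENNReal.ofReal c ≤ 1 := by
    calc (1 + m * ENNReal.ofReal ε) * ENNReal.ofReal c
        ≤ (1 + m * ENNReal.ofReal ε) * ∑' A : P, μ.toOuterMeasure A := by
          gcongr
          exact hPμ.trans (toOuterMeasure_sUnion_le μ P)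
      _ = ∑' A : P, (1 + m * ENNReal.ofReal ε) * μ.toOuterMeasure A :=
          ENNReal.tsum_mul_left.symm
      _ ≤ ∑' A : P, μ.toOuterMeasure (Metric.cthickening (m * R) (A : Set X)) :=
          ENNReal.tsum_le_tsum fun A => hgrow A A.2 m le_rfl
      _ ≤ 1 := tsum_toOuterMeasure_le μ _ fun A B hAB =>
          disjoint_cthickening (by positivity) (by linarith)
            (hPs A A.2 B B.2 fun h => hAB (Subtype.ext h))
  have hle' : ENNReal.ofReal ((1 + m * ε) * c) ≤ ENNReal.ofReal 1 := by
    rw [ENNReal.ofReal_mul (by positivity), ENNReal.ofReal_add zero_le_one (by positivity),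
      ENNReal.ofReal_mul (by positivity), ENNReal.ofReal_natCast, ENNReal.ofReal_one]
    exact hle
  rw [ENNReal.ofReal_le_ofReal_iff zero_le_one] at hle'
  rw [div_lt_iff₀ (by positivity)] at hm
  nlinarith

end Sparsification

/-! ### Pointwise calculus in the weighted L² space -/

section WeightedL2

theorem discreteMeasure_singleton {X : Type*} (μ : PMF X) (x : X) :
    discreteMeasure μ {x} = μ x :=
  letI : MeasurableSpace X := ⊤
  PMF.toMeasure_apply_singleton μ x trivial

theorem forall_of_ae {X : Type*} {μ : PMF X} {p : X → Prop} (h : ∀ᵐ x ∂(discreteMeasure μ), p x) :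
    ∀ x ∈ μ.support, p x := by
  let _ : MeasurableSpace X := ⊤
  intro x hx
  by_contra hp
  have h0 : discreteMeasure μ {x} = 0 :=
    measure_mono_null (Set.singleton_subset_iff.2 hp) (ae_iff.1 h)
  rw [discreteMeasure_singleton] at h0
  exact (PMF.mem_support_iff _ _).1 hx h0

variable {X : Type*} {μ : PMF X} {H : Type*} [NormedAddCommGroup H]

/-- The restriction of a class in `l²(X, μ, H)` to a set of points. -/
def WeightedL2.restrict (A : Set X) (φ : WeightedL2 μ H) : WeightedL2 μ H :=
  letI : MeasurableSpace X := ⊤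
  ((Lp.memLp φ).indicator (s := A) trivial).toLp

theorem WeightedL2.restrict_apply (A : Set X) (φ : WeightedL2 μ H) {x : X} (hx : x ∈ μ.support) :
    WeightedL2.restrict A φ x = A.indicator φ x :=
  letI : MeasurableSpace X := ⊤
  forall_of_ae (MemLp.coeFn_toLp _) x hx

theorem single_apply (y : X) (v : H) {x : X} (hx : x ∈ μ.support) :
    single μ y v x = ({y} : Set X).indicator (fun _ => v) x :=
  letI : MeasurableSpace X := ⊤
  forall_of_ae (indicatorConstLp_coeFn (μ := discreteMeasure μ)) x hx

theorem supp_restrict_subset (A : Set X) (φ : WeightedL2 μ H) :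
    supp (WeightedL2.restrict A φ) ⊆ A := by
  rintro x ⟨hx, h⟩
  rw [WeightedL2.restrict_apply _ _ hx] at h
  exact Set.mem_of_indicator_ne_zero h

variable [Countable X]

theorem ae_of_forall {p : X → Prop} (h : ∀ x ∈ μ.support, p x) :
    ∀ᵐ x ∂(discreteMeasure μ), p x := by
  let _ : MeasurableSpace X := ⊤
  rw [ae_iff_of_countable]
  intro x hx
  rw [discreteMeasure_singleton] at hx
  exact h x ((PMF.mem_support_iff _ _).2 hx)

theorem WeightedL2.ext {φ ψ : WeightedL2 μ H} (h : ∀ x ∈ μ.support, φ x = ψ x) : φ = ψ :=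
  letI : MeasurableSpace X := ⊤
  Lp.ext (ae_of_forall h)

theorem WeightedL2.enorm_sq (φ : WeightedL2 μ H) : ‖φ‖ₑ ^ 2 = ∑' x, μ x * ‖φ x‖ₑ ^ 2 := by
  let _ : MeasurableSpace X := ⊤
  rw [Lp.enorm_def, eLpNorm_eq_lintegral_rpow_enorm_toReal two_ne_zero ENNReal.ofNat_ne_top,
    ← ENNReal.rpow_natCast, ← ENNReal.rpow_mul, lintegral_countable']
  simp only [ENNReal.toReal_ofNat, Nat.cast_ofNat, one_div]
  rw [inv_mul_cancel₀ two_ne_zero, ENNReal.rpow_one]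
  refine tsum_congr fun x => ?_
  rw [discreteMeasure_singleton, mul_comm, ENNReal.rpow_ofNat]

theorem WeightedL2.mul_norm_sq_le (φ : WeightedL2 μ H) (x : X) :
    (μ x).toReal * ‖φ x‖ ^ 2 ≤ ‖φ‖ ^ 2 := by
  have h : μ x * ‖φ x‖ₑ ^ 2 ≤ ‖φ‖ₑ ^ 2 := by
    rw [WeightedL2.enorm_sq]
    exact ENNReal.le_tsum (f := fun x => μ x * ‖φ x‖ₑ ^ 2) x
  have h' := ENNReal.toReal_mono (by simp) h
  simpa using h'

/-- Evaluation at a point of positive mass. -/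
def WeightedL2.eval [NormedSpace ℂ H] (x : X) (hx : x ∈ μ.support) : WeightedL2 μ H →L[ℂ] H :=
  letI : MeasurableSpace X := ⊤
  LinearMap.mkContinuousOfExistsBound
    { toFun := fun φ => φ x
      map_add' := fun φ ψ => forall_of_ae (Lp.coeFn_add φ ψ) x hx
      map_smul' := fun c φ => forall_of_ae (Lp.coeFn_smul c φ) x hx } <| by
    have hpos : 0 < (μ x).toReal :=
      ENNReal.toReal_pos ((PMF.mem_support_iff _ _).1 hx) (μ.apply_ne_top x)
    have hle : (μ x).toReal ≤ 1 := ENNReal.toReal_le_of_le_ofReal zero_le_one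
      (by simpa using μ.coe_le_one x)
    -- The sharp bound is the inverse square root of the mass; its inverse also works because the
    -- mass is at most 1.
    refine ⟨(μ x).toReal⁻¹, fun φ => ?_⟩
    have h := WeightedL2.mul_norm_sq_le φ x
    rw [inv_mul_eq_div, le_div_iff₀' hpos]
    refine le_of_sq_le_sq ?_ (norm_nonneg φ)
    rw [mul_pow]
    refine le_trans ?_ h
    gcongr
    · exact pow_le_of_le_one hpos.le hle two_ne_zero
    · exact le_rfl

theorem WeightedL2.eval_apply [NormedSpace ℂ H] (x : X) (hx : x ∈ μ.support)
    (φ : WeightedL2 μ H) : WeightedL2.eval x hx φ = φ x := rfl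

/-- Propagation is a condition on T applied to point masses; this expansion, whose remainder is the
tail of a convergent series, carries it over to all vectors. -/
theorem hasSum_single [NormedSpace ℂ H] (φ : WeightedL2 μ H) :
    HasSum (fun y => single μ y (φ y)) φ := by
  classical
  have happ : ∀ (s : Finset X), ∀ x ∈ μ.support,
      (∑ y ∈ s, single μ y (φ y) - φ : WeightedL2 μ H) x
        = -((s : Set X)ᶜ.indicator φ x) := by
    intro s x hx
    rw [← WeightedL2.eval_apply x hx, map_sub, map_sum]
    simp only [WeightedL2.eval_apply, single_apply _ _ hx]
    by_cases hxs : x ∈ s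
    · rw [Finset.sum_eq_single x]
      · simp [hxs]
      · exact fun y _ hy => Set.indicator_of_notMem (fun h => hy h.symm) _
      · exact fun h => absurd hxs h
    · rw [Finset.sum_eq_zero]
      · simp [hxs]
      · exact fun y hy => Set.indicator_of_notMem (fun h => hxs (by rwa [h])) _
  have hnorm : ∀ s : Finset X, edist (∑ y ∈ s, single μ y (φ y)) φ
      = (∑' b : {x // x ∉ s}, μ b * ‖φ b‖ₑ ^ 2) ^ (1 / 2 : ℝ) := by
    intro s
    have h1 : ‖∑ y ∈ s, single μ y (φ y) - φ‖ₑ ^ 2 = ∑' b : {x // x ∉ s}, μ b * ‖φ b‖ₑ ^ 2 := by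
      rw [WeightedL2.enorm_sq]
      refine Eq.trans ?_ (tsum_subtype ((s : Set X)ᶜ) fun x => μ x * ‖φ x‖ₑ ^ 2).symm
      refine tsum_congr fun x => ?_
      by_cases hx : x ∈ μ.support
      · rw [happ s x hx]
        by_cases hxs : x ∈ s <;> simp [hxs]
      · have : μ x = 0 := (PMF.apply_eq_zero_iff _ _).2 hx
        by_cases hxs : x ∈ s <;> simp [hxs, this]
    rw [← h1, edist_eq_enorm_sub, ← ENNReal.rpow_ofNat, ← ENNReal.rpow_mul]
    norm_num
  have hfin : ∑' x, μ x * ‖φ x‖ₑ ^ 2 ≠ ∞ := by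
    rw [← WeightedL2.enorm_sq]
    simp
  have hlim := (ENNReal.continuous_rpow_const (y := 1 / 2)).tendsto 0 |>.comp
    (ENNReal.tendsto_tsum_compl_atTop_zero hfin)
  rw [ENNReal.zero_rpow_of_pos (by norm_num)] at hlim
  refine tendsto_iff_edist_tendsto_0.2 ?_
  simp only [hnorm]
  exact hlim

theorem WeightedL2.restrict_add_compl (A : Set X) (φ : WeightedL2 μ H) :
    WeightedL2.restrict A φ + WeightedL2.restrict Aᶜ φ = φ := by
  let _ : MeasurableSpace X := ⊤
  refine WeightedL2.ext fun x hx => ?_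
  rw [forall_of_ae (Lp.coeFn_add _ _) x hx, Pi.add_apply, WeightedL2.restrict_apply _ _ hx,
    WeightedL2.restrict_apply _ _ hx]
  exact congrFun (Set.indicator_self_add_compl A φ) x

theorem WeightedL2.enorm_restrict_sq (A : Set X) (φ : WeightedL2 μ H) :
    ‖WeightedL2.restrict A φ‖ₑ ^ 2 = ∑' x, A.indicator (fun x => μ x * ‖φ x‖ₑ ^ 2) x := by
  rw [WeightedL2.enorm_sq]
  refine tsum_congr fun x => ?_
  by_cases hx : x ∈ μ.support
  · rw [WeightedL2.restrict_apply _ _ hx]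
    by_cases hA : x ∈ A <;> simp [hA]
  · have : μ x = 0 := (PMF.apply_eq_zero_iff _ _).2 hx
    by_cases hA : x ∈ A <;> simp [hA, this]

theorem supp_smul_subset [NormedSpace ℂ H] (c : ℂ) (φ : WeightedL2 μ H) :
    supp (c • φ) ⊆ supp φ := by
  rintro x ⟨hx, h⟩
  refine ⟨hx, fun h0 => h ?_⟩
  rw [← WeightedL2.eval_apply x hx, map_smul, WeightedL2.eval_apply, h0, smul_zero]

end WeightedL2

/-! ### Sparsification implies operator norm localisation -/

section Localisation

variable {X : Type*} [MetricSpace X] [Countable X] {μ : PMF X}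
  {H : Type*} [NormedAddCommGroup H] [InnerProductSpace ℂ H]

/-- The value at x is the sum of the matrix entries T_{x,y} applied to the restricted vector at y:
inside the thickening that vector vanishes, and outside it y is farther than R from x. -/
theorem HasPropagation.apply_restrict_compl {R : ℝ} {T : WeightedL2 μ H →L[ℂ] WeightedL2 μ H}
    (hT : HasPropagation R T) (A : Set X) (φ : WeightedL2 μ H) {x : X} (hx : x ∈ μ.support)
    (hxA : x ∈ A) : T (WeightedL2.restrict (Metric.cthickening R A)ᶜ φ) x = 0 := by
  set ψ := WeightedL2.restrict (Metric.cthickening R A)ᶜ φ with hψ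
  have h := ((hasSum_single ψ).mapL T).mapL (WeightedL2.eval x hx)
  have hzero : ∀ y, WeightedL2.eval x hx (T (single μ y (ψ y))) = 0 := by
    intro y
    rw [WeightedL2.eval_apply]
    by_cases hy : y ∈ μ.support
    · by_cases hyA : y ∈ Metric.cthickening R A
      · have h0 : ψ y = 0 := by
          rw [hψ, WeightedL2.restrict_apply _ _ hy]
          exact Set.indicator_of_notMem (Set.notMem_compl_iff.2 hyA) _
        have h1 : single μ y (0 : H) = 0 := by
          refine WeightedL2.ext fun z hz => ?_
          rw [single_apply _ _ hz, ← WeightedL2.eval_apply z hz 0, map_zero]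
          simp
        rw [h0, h1, map_zero, ← WeightedL2.eval_apply x hx, map_zero]
      · refine hT x hx y hy ?_ _
        by_contra! hle
        refine hyA (Metric.mem_cthickening_of_dist_le y x R A hxA ?_)
        rwa [dist_comm]
    · have h1 : single μ y (ψ y) = 0 := by
        refine WeightedL2.ext fun z hz => ?_
        rw [single_apply _ _ hz, ← WeightedL2.eval_apply z hz 0, map_zero]
        exact Set.indicator_of_notMem (fun h => hy (by rwa [← h])) _
      rw [h1, map_zero, ← WeightedL2.eval_apply x hx, map_zero]
  simp only [hzero] at h
  exact h.unique hasSum_zero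

theorem exists_unit_vector_supp_subsingleton [Nontrivial H] (μ : PMF X) :
    ∃ φ : WeightedL2 μ H, ‖φ‖ = 1 ∧ Metric.ediam (supp φ) = 0 := by
  obtain ⟨x, hx⟩ := μ.support_nonempty
  obtain ⟨v, hv⟩ := exists_ne (0 : H)
  have hne : single μ x v ≠ 0 := by
    intro h0
    have h1 := single_apply x v hx
    rw [h0, ← WeightedL2.eval_apply x hx, map_zero] at h1
    exact hv (by simpa using h1.symm)
  refine ⟨((‖single μ x v‖⁻¹ : ℝ) : ℂ) • single μ x v, ?_, ?_⟩
  · rw [norm_smul]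
    simp [hne]
  · refine Metric.ediam_subsingleton (Set.Subsingleton.anti (t := {x}) Set.subsingleton_singleton ?_)
    refine (supp_smul_subset _ _).trans ?_
    rintro y ⟨hy, h⟩
    rw [single_apply _ _ hy] at h
    exact Set.mem_of_indicator_ne_zero h

/-- `MSP` is applied to the density of |Tψ|² for a nearly norming ψ. On a piece A, Tψ agrees with T
applied to ψ cut off to the R-thickening of A, and these cut-offs have disjoint supports. If all of
them violated the bound, summing squares would give c‖Tψ‖² ≤ (c‖T‖/2)²‖ψ‖², which contradicts ‖Tψ‖ >
‖T‖‖ψ‖/2 since c² ≤ c. -/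
theorem MSP.exists_localised {c R S : ℝ} (hc : 0 < c) (hc1 : c ≤ 1) (hR : 0 < R) (hS : 0 < S)
    (h : ∀ μ : PMF X, ∃ P : Set (Set X), P.PairwiseDisjoint id ∧
      ENNReal.ofReal c ≤ μ.toOuterMeasure (⋃₀ P) ∧
      (∀ A ∈ P, Metric.ediam A ≤ ENNReal.ofReal S) ∧
      ∀ A ∈ P, ∀ B ∈ P, A ≠ B → ENNReal.ofReal (2 * R + 1) < ⨅ a ∈ A, ⨅ b ∈ B, edist a b)
    {T : WeightedL2 μ H →L[ℂ] WeightedL2 μ H} (hT : HasPropagation R T) (hT0 : T ≠ 0) :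
    ∃ ψ : WeightedL2 μ H, ψ ≠ 0 ∧ Metric.ediam (supp ψ) ≤ ENNReal.ofReal (S + 2 * R) ∧
      c / 2 * ‖T‖ * ‖ψ‖ ≤ ‖T ψ‖ := by
  have hTpos : 0 < ‖T‖ := (norm_pos_iff (a := T)).2 hT0
  obtain ⟨ψ, hψ⟩ := T.exists_mul_lt_of_lt_opNorm (r := ‖T‖ / 2) (by positivity) (by linarith)
  have hTψ : 0 < ‖T ψ‖ := lt_of_le_of_lt (by positivity) hψ
  have hsum0 : ∑' x, μ x * ‖T ψ x‖ₑ ^ 2 ≠ 0 := by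
    rw [← WeightedL2.enorm_sq]
    simpa using norm_pos_iff.1 hTψ
  have hsumt : ∑' x, μ x * ‖T ψ x‖ₑ ^ 2 ≠ ∞ := by
    rw [← WeightedL2.enorm_sq]
    simp
  obtain ⟨P, -, hPμ, hPd, hPs⟩ := h (PMF.normalize _ hsum0 hsumt)
  have hmass : ENNReal.ofReal c * ‖T ψ‖ₑ ^ 2
      ≤ ∑' A : P, ∑' x, (A : Set X).indicator (fun x => μ x * ‖T ψ x‖ₑ ^ 2) x := by
    have h1 := hPμ.trans (toOuterMeasure_sUnion_le _ P)
    have h2 : ∀ A : Set X, (PMF.normalize _ hsum0 hsumt).toOuterMeasure A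
        = (∑' x, A.indicator (fun x => μ x * ‖T ψ x‖ₑ ^ 2) x) * (‖T ψ‖ₑ ^ 2)⁻¹ := by
      intro A
      rw [PMF.toOuterMeasure_apply, ← ENNReal.tsum_mul_right]
      refine tsum_congr fun x => ?_
      by_cases hx : x ∈ A
      · simp only [Set.indicator_of_mem hx, PMF.normalize_apply, WeightedL2.enorm_sq]
      · simp only [Set.indicator_of_notMem hx, zero_mul]
    simp only [h2] at h1
    rw [ENNReal.tsum_mul_right, ← div_eq_mul_inv] at h1
    exact ENNReal.mul_le_of_le_div h1
  set Q : P → WeightedL2 μ H := fun A => WeightedL2.restrict (Metric.cthickening R (A : Set X)) ψ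
    with hQ
  have hloc : ∀ A : P, ∑' x, (A : Set X).indicator (fun x => μ x * ‖T ψ x‖ₑ ^ 2) x
      ≤ ‖T (Q A)‖ₑ ^ 2 := by
    intro A
    rw [WeightedL2.enorm_sq]
    refine ENNReal.tsum_le_tsum fun x => ?_
    by_cases hxA : x ∈ (A : Set X)
    · rw [Set.indicator_of_mem hxA]
      by_cases hx : x ∈ μ.support
      · have h1 : T ψ x = T (Q A) x := by
          conv_lhs => rw [← WeightedL2.restrict_add_compl (Metric.cthickening R (A : Set X)) ψ]
          rw [map_add, ← WeightedL2.eval_apply x hx, map_add, WeightedL2.eval_apply,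
            WeightedL2.eval_apply, hT.apply_restrict_compl _ _ hx hxA, add_zero]
        rw [h1]
      · have : μ x = 0 := (PMF.apply_eq_zero_iff _ _).2 hx
        simp [this]
    · rw [Set.indicator_of_notMem hxA]
      exact zero_le
  have horth : ∑' A : P, ‖Q A‖ₑ ^ 2 ≤ ‖ψ‖ₑ ^ 2 := by
    simp only [hQ, WeightedL2.enorm_restrict_sq]
    rw [ENNReal.tsum_comm, WeightedL2.enorm_sq ψ]
    refine ENNReal.tsum_le_tsum fun x => ?_
    by_cases hx : ∃ A : P, x ∈ Metric.cthickening R (A : Set X)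
    · obtain ⟨A, hA⟩ := hx
      rw [tsum_eq_single A]
      · exact Set.indicator_le_self _ _ _
      · intro B hB
        refine Set.indicator_of_notMem (fun hxB => ?_) _
        exact Set.disjoint_left.1 (disjoint_cthickening hR.le (by linarith)
          (hPs B B.2 A A.2 fun h => hB (Subtype.ext h))) hxB hA
    · have : ∀ A : P, (Metric.cthickening R (A : Set X)).indicator
          (fun x => μ x * ‖ψ x‖ₑ ^ 2) x = 0 := fun A =>
        Set.indicator_of_notMem (fun hA => hx ⟨A, hA⟩) _
      simp [this]
  by_contra! hcon
  have hsmall : ∀ A : P, ‖T (Q A)‖ₑ ^ 2 ≤ ENNReal.ofReal ((c / 2 * ‖T‖) ^ 2) * ‖Q A‖ₑ ^ 2 := by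
    intro A
    have h1 : ‖T (Q A)‖ ≤ c / 2 * ‖T‖ * ‖Q A‖ := by
      by_cases h0 : Q A = 0
      · simp [h0]
      · refine (hcon (Q A) h0 ?_).le
        exact (Metric.ediam_mono (supp_restrict_subset _ _)).trans
          (ediam_cthickening_le_ofReal hR.le hS.le (hPd A A.2))
    rw [← ofReal_norm, ← ofReal_norm, ← ENNReal.ofReal_pow (norm_nonneg _),
      ← ENNReal.ofReal_pow (norm_nonneg _), ← ENNReal.ofReal_mul (by positivity), ← mul_pow]
    gcongr
  have hfinal : ENNReal.ofReal c * ‖T ψ‖ₑ ^ 2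
      ≤ ENNReal.ofReal ((c / 2 * ‖T‖) ^ 2) * ‖ψ‖ₑ ^ 2 := by
    calc _ ≤ _ := hmass
      _ ≤ ∑' A : P, ENNReal.ofReal ((c / 2 * ‖T‖) ^ 2) * ‖Q A‖ₑ ^ 2 :=
        ENNReal.tsum_le_tsum fun A => (hloc A).trans (hsmall A)
      _ ≤ _ := by
        rw [ENNReal.tsum_mul_left]
        gcongr
  rw [← ofReal_norm, ← ofReal_norm, ← ENNReal.ofReal_pow (norm_nonneg _),
    ← ENNReal.ofReal_pow (norm_nonneg _), ← ENNReal.ofReal_mul (by positivity),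
    ← ENNReal.ofReal_mul (by positivity), ENNReal.ofReal_le_ofReal_iff (by positivity)] at hfinal
  have hsq : (‖T‖ / 2 * ‖ψ‖) ^ 2 < ‖T ψ‖ ^ 2 := by
    gcongr
  have h1 : c * (‖T‖ / 2 * ‖ψ‖) ^ 2 < c * ‖T ψ‖ ^ 2 := by gcongr
  have h2 : (c / 2 * ‖T‖) ^ 2 * ‖ψ‖ ^ 2 ≤ c * (‖T‖ / 2 * ‖ψ‖) ^ 2 := by
    have : c ^ 2 ≤ c := pow_le_of_le_one hc.le hc1 two_ne_zero
    calc (c / 2 * ‖T‖) ^ 2 * ‖ψ‖ ^ 2 = c ^ 2 * (‖T‖ / 2 * ‖ψ‖) ^ 2 := by ring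
      _ ≤ _ := by gcongr
  linarith

end Localisation

theorem MSP.onl {X : Type*} [MetricSpace X] [Countable X] (h : MSP X) : ONL X := by
  obtain ⟨c, hc, h⟩ := h
  have hc' : 0 < min c 1 := by positivity
  refine ⟨min c 1 / 2, by positivity, fun R hR => ?_⟩
  obtain ⟨S, hS, h⟩ := h (2 * R + 1) (by positivity)
  refine ⟨S + 2 * R, by positivity, ?_⟩
  intro μ H _ _ _ _ _ T hT
  by_cases hT0 : T = 0
  · obtain ⟨φ, hφ, hd⟩ := exists_unit_vector_supp_subsingleton (H := H) μ
    exact ⟨φ, hφ, by rw [hd]; exact zero_le, by simp [hT0]⟩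
  obtain ⟨ψ, hψ, hd, hle⟩ := MSP.exists_localised hc' (min_le_right _ _) hR hS
    (fun μ => (h μ).imp fun P hP => ⟨hP.1, (ENNReal.ofReal_le_ofReal (min_le_left _ _)).trans
      hP.2.1, hP.2.2⟩) hT hT0
  have hpos : 0 < ‖ψ‖ := norm_pos_iff.2 hψ
  refine ⟨((‖ψ‖⁻¹ : ℝ) : ℂ) • ψ, ?_, (Metric.ediam_mono (supp_smul_subset _ _)).trans hd, ?_⟩
  · rw [norm_smul]
    simp [hψ]
  · rw [map_smul, norm_smul, Complex.norm_real, norm_inv, norm_norm, inv_mul_eq_div,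
      le_div_iff₀ hpos]
    exact hle

/-! ### Geometry of box spaces, uniformly in n -/

namespace IsBoxSpace

variable {Γ : Type*} [Group Γ] {S : Finset Γ} {N : ℕ → Subgroup Γ} [∀ n, (N n).Normal]
  [MetricSpace (Σ n, Γ ⧸ N n)]

/-- The endpoints differ by a word of length at most r in the generators and their inverses; these
words are taken in Γ, so the set does not depend on n. -/
theorem exists_finite_of_walk (S : Finset Γ) (N : ℕ → Subgroup Γ) [∀ n, (N n).Normal] (r : ℕ) :
    ∃ B : Set Γ, B.Finite ∧ 1 ∈ B ∧ ∀ (n : ℕ) (x y : Γ ⧸ N n)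
      (p : (cayleyGraph ((QuotientGroup.mk : Γ → Γ ⧸ N n) '' (S : Set Γ))).Walk x y),
      p.length ≤ r → ∃ g ∈ B, y = x * (g : Γ ⧸ N n) := by
  induction r with
  | zero =>
    refine ⟨{1}, Set.finite_singleton _, rfl, fun n x y p hp => ⟨1, rfl, ?_⟩⟩
    rw [QuotientGroup.mk_one, mul_one]
    exact (SimpleGraph.Walk.eq_of_length_eq_zero (Nat.le_zero.1 hp)).symm
  | succ r ih =>
    obtain ⟨B, hB, h1, ih⟩ := ih
    refine ⟨insert 1 (((S : Set Γ) ∪ (S : Set Γ)⁻¹) * B),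
      ((S.finite_toSet.union S.finite_toSet.inv).mul hB).insert 1, Set.mem_insert _ _, ?_⟩
    intro n x y p hp
    cases p with
    | nil => exact ⟨1, Set.mem_insert _ _, by simp⟩
    | @cons _ v _ hadj q =>
      obtain ⟨g, hg, rfl⟩ := ih n v y q (by simpa using hp)
      rw [cayleyGraph, SimpleGraph.fromRel_adj] at hadj
      obtain ⟨-, ⟨_, ⟨s, hs, rfl⟩, rfl⟩ | ⟨_, ⟨s, hs, rfl⟩, rfl⟩⟩ := hadj
      · refine ⟨s * g, Or.inr (Set.mul_mem_mul (Or.inl hs) hg), ?_⟩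
        rw [QuotientGroup.mk_mul, mul_assoc]
      · refine ⟨s⁻¹ * g, Or.inr (Set.mul_mem_mul (Or.inr (by simpa using hs)) hg), ?_⟩
        rw [QuotientGroup.mk_mul, QuotientGroup.mk_inv]
        group

/-- Points of a component at bounded distance differ by an element of a fixed finite set. -/
theorem exists_finite_of_dist_le (hX : IsBoxSpace S N) (R : ℝ) :
    ∃ B : Set Γ, B.Finite ∧ ∀ (n : ℕ) (x y : Γ ⧸ N n),
      dist (⟨n, x⟩ : Σ n, Γ ⧸ N n) ⟨n, y⟩ ≤ R → ∃ g ∈ B, y = x * (g : Γ ⧸ N n) := by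
  obtain ⟨B, hB, -, h⟩ := exists_finite_of_walk S N ⌊R⌋₊
  refine ⟨B, hB, fun n x y hxy => ?_⟩
  obtain ⟨p, hp⟩ := (hX.isSpaceOfGraphs.connected n).exists_walk_length_eq_dist x y
  refine h n x y p ?_
  rw [hp]
  rw [hX.isSpaceOfGraphs.dist_eq] at hxy
  exact Nat.le_floor hxy

theorem exists_dist_mul_le (hX : IsBoxSpace S N) (g : Γ) :
    ∃ r : ℝ, ∀ (n : ℕ) (x : Γ ⧸ N n),
      dist (⟨n, x⟩ : Σ n, Γ ⧸ N n) ⟨n, x * (g : Γ ⧸ N n)⟩ ≤ r := by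
  have hg : g ∈ Subgroup.closure (S : Set Γ) := hX.generates ▸ Subgroup.mem_top g
  induction hg using Subgroup.closure_induction with
  | mem s hs =>
    refine ⟨1, fun n x => ?_⟩
    -- A generator may become trivial in the quotient, and then it gives no edge.
    by_cases hx : x = x * (s : Γ ⧸ N n)
    · rw [← hx, dist_self]
      exact zero_le_one
    · rw [hX.isSpaceOfGraphs.dist_eq]
      have : (cayleyGraph ((QuotientGroup.mk : Γ → Γ ⧸ N n) '' (S : Set Γ))).Adj x
          (x * (s : Γ ⧸ N n)) := by
        rw [cayleyGraph, SimpleGraph.fromRel_adj]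
        exact ⟨hx, Or.inl ⟨s, ⟨s, hs, rfl⟩, rfl⟩⟩
      rw [SimpleGraph.dist_eq_one_iff_adj.2 this, Nat.cast_one]
  | one => exact ⟨0, fun n x => by simp⟩
  | mul g h _ _ hg hh =>
    obtain ⟨r, hr⟩ := hg
    obtain ⟨r', hr'⟩ := hh
    refine ⟨r + r', fun n x => (dist_triangle _ ⟨n, x * (g : Γ ⧸ N n)⟩ _).trans ?_⟩
    have := hr' n (x * (g : Γ ⧸ N n))
    rw [mul_assoc, ← QuotientGroup.mk_mul] at this
    exact add_le_add (hr n x) this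
  | inv g _ hg =>
    obtain ⟨r, hr⟩ := hg
    refine ⟨r, fun n x => ?_⟩
    have := hr n (x * ((g⁻¹ : Γ) : Γ ⧸ N n))
    rw [dist_comm, QuotientGroup.mk_inv, inv_mul_cancel_right] at this
    rwa [QuotientGroup.mk_inv]

/-- Right multiplication by the elements of a finite set moves points by a bounded distance. -/
theorem exists_forall_dist_mul_le (hX : IsBoxSpace S N) {F : Set Γ} (hF : F.Finite) :
    ∃ L : ℝ, 0 < L ∧ ∀ g ∈ F, ∀ (n : ℕ) (x : Γ ⧸ N n),
      dist (⟨n, x⟩ : Σ n, Γ ⧸ N n) ⟨n, x * (g : Γ ⧸ N n)⟩ ≤ L := by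
  choose r hr using hX.exists_dist_mul_le
  obtain ⟨L, hL⟩ := (hF.image r).bddAbove
  exact ⟨max L 1, by positivity, fun g hg n x =>
    (hr g n x).trans ((hL ⟨g, hg, rfl⟩).trans (le_max_left _ _))⟩

theorem eventually_fst_eq (hX : IsBoxSpace S N) (R : ℝ) :
    ∀ᶠ n in atTop, ∀ (x : Γ ⧸ N n) (y : Σ n, Γ ⧸ N n),
      dist (⟨n, x⟩ : Σ n, Γ ⧸ N n) y ≤ R → y.1 = n := by
  filter_upwards [hX.isSpaceOfGraphs.separated (R + 1)] with n hn x y hxy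
  by_contra hne
  linarith [hn x y hne]

/-- Only finitely many elements g⁻¹h have to be kept out of the subgroups; each nontrivial one
leaves some subgroup, hence all later ones. -/
theorem eventually_injOn (hX : IsBoxSpace S N) {B : Set Γ} (hB : B.Finite) :
    ∀ᶠ n in atTop, Set.InjOn (QuotientGroup.mk : Γ → Γ ⧸ N n) B := by
  have h : ∀ g ∈ B, ∀ h ∈ B, ∀ᶠ n in atTop,
      (QuotientGroup.mk g : Γ ⧸ N n) = QuotientGroup.mk h → g = h := by
    intro g _ h _
    by_cases hgh : g = h
    · exact Eventually.of_forall fun _ _ => hgh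
    have hnot : g⁻¹ * h ∉ ⨅ n, N n := by
      rw [hX.iInf_eq_bot, Subgroup.mem_bot, inv_mul_eq_one]
      exact hgh
    rw [Subgroup.mem_iInf, not_forall] at hnot
    obtain ⟨m, hm⟩ := hnot
    filter_upwards [eventually_ge_atTop m] with n hn heq
    exact absurd (hX.antitone hn (QuotientGroup.eq.1 heq)) hm
  have h' := (hB.eventually_all).2 fun g hg => (hB.eventually_all).2 fun k hk => h g hg k hk
  filter_upwards [h'] with n hn g hg k hk hgk
  exact hn g hg k hk hgk

end IsBoxSpace

/-! ### Uniform measures on Følner sets -/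

section Reiter

theorem toReal_map_uniformOfFinset {α β : Type*} [DecidableEq β] {F : Finset α}
    (hF : F.Nonempty) (u : α → β) (z : β) :
    ((PMF.uniformOfFinset F hF).map u z).toReal
      = (∑ g ∈ F, if z = u g then (1 : ℝ) else 0) / F.card := by
  classical
  rw [PMF.map_apply, tsum_eq_sum (s := F)]
  · rw [ENNReal.toReal_sum, Finset.sum_div]
    · refine Finset.sum_congr rfl fun g hg => ?_
      split_ifs <;> simp [hg]
    · intro g hg
      split_ifs <;> simp [hg, hF.ne_empty]
  · intro g hg
    simp [hg]

/-- Composing u with multiplication by k amounts to replacing F by kF, so the two sums differ only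
by terms from kF ∆ F, each of total mass 1/|F|. -/
theorem tsum_abs_map_uniformOfFinset_sub_le {Γ β : Type*} [Group Γ] [DecidableEq Γ] {F : Finset Γ}
    (hF : F.Nonempty) (u : Γ → β) (k : Γ) :
    ∑' z, |((PMF.uniformOfFinset F hF).map u z).toReal
        - ((PMF.uniformOfFinset F hF).map (fun g => u (k * g)) z).toReal|
      ≤ ((k • F) ∆ F).card / F.card := by
  classical
  set D := (k • F) ∆ F with hD
  have hle : ∀ z, |((PMF.uniformOfFinset F hF).map u z).toReal
        - ((PMF.uniformOfFinset F hF).map (fun g => u (k * g)) z).toReal|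
      ≤ (∑ g ∈ D, if z = u g then (1 : ℝ) else 0) / F.card := by
    intro z
    have h1 : ∑ g ∈ F, (if z = u (k * g) then (1 : ℝ) else 0)
        = ∑ g ∈ k • F, if z = u g then (1 : ℝ) else 0 := by
      rw [← Finset.image_smul, Finset.sum_image (MulAction.injective k).injOn]
      rfl
    rw [toReal_map_uniformOfFinset, toReal_map_uniformOfFinset, h1, ← sub_div, abs_div,
      Nat.abs_cast]
    gcongr
    rw [← Finset.sum_sdiff_sub_sum_sdiff]
    have hpos : ∀ s : Finset Γ, 0 ≤ ∑ g ∈ s, if z = u g then (1 : ℝ) else 0 := fun s =>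
      Finset.sum_nonneg fun g _ => by split_ifs <;> norm_num
    have h2 : ∑ g ∈ D, (if z = u g then (1 : ℝ) else 0)
        = ∑ g ∈ (k • F) \ F, (if z = u g then (1 : ℝ) else 0)
          + ∑ g ∈ F \ (k • F), if z = u g then (1 : ℝ) else 0 :=
      Finset.sum_union disjoint_sdiff_sdiff
    rw [h2, abs_le]
    constructor <;> linarith [hpos ((k • F) \ F), hpos (F \ (k • F))]
  have hsum : HasSum (fun z => (∑ g ∈ D, if z = u g then (1 : ℝ) else 0) / F.card)
      (D.card / F.card) := by
    refine HasSum.div_const ?_ _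
    rw [Finset.card_eq_sum_ones, Nat.cast_sum]
    refine hasSum_sum fun g _ => ?_
    simpa using hasSum_ite_eq (u g) (1 : ℝ)
  rw [← hsum.tsum_eq]
  exact (Summable.of_nonneg_of_le (fun _ => abs_nonneg _) hle hsum.summable).tsum_le_tsum hle
    hsum.summable

end Reiter

/-! ### Amenability implies A; `ULA` implies amenability -/

section Amenability

variable {Γ : Type*} [Group Γ] {S : Finset Γ} {N : ℕ → Subgroup Γ} [∀ n, (N n).Normal]
  [MetricSpace (Σ n, Γ ⧸ N n)]

/-- In late components `ξ x` is uniform on xF; nearby points have the form x and xk, and xkF is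
compared with xF by the left Følner condition. The finitely many points of the early components all
receive one Dirac mass. -/
theorem IsAmenable.propertyA (hX : IsBoxSpace S N) (hΓ : IsAmenable Γ) :
    PropertyA (Σ n, Γ ⧸ N n) := by
  classical
  intro R ε hR hε
  obtain ⟨B, hB, hBR⟩ := hX.exists_finite_of_dist_le R
  obtain ⟨F, hF, hFne, hFB⟩ := hΓ B ε hB hε
  lift F to Finset Γ using hF
  rw [Finset.coe_nonempty] at hFne
  obtain ⟨n₀, hn₀⟩ := eventually_atTop.1 (hX.eventually_fst_eq R)
  obtain ⟨L, hL, hLF⟩ := hX.exists_forall_dist_mul_le F.finite_toSet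
  have hfin : {x : Σ n, Γ ⧸ N n | x.1 < n₀}.Finite := by
    have : ∀ n, Finite (Γ ⧸ N n) := hX.isSpaceOfGraphs.finite
    refine ((Set.finite_Iio n₀).biUnion (t := fun n => Set.range
      (Sigma.mk (β := fun n => Γ ⧸ N n) n)) fun n _ => Set.finite_range _).subset ?_
    rintro ⟨n, x⟩ hx
    exact Set.mem_biUnion (x := n) hx ⟨x, rfl⟩
  set o : Σ n, Γ ⧸ N n := ⟨0, 1⟩
  obtain ⟨M, hM⟩ := (hfin.image fun x => dist o x).bddAbove
  refine ⟨max L M, lt_max_of_lt_left hL, fun x => if n₀ ≤ x.1 then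
    (PMF.uniformOfFinset F hFne).map fun g : Γ => ⟨x.1, x.2 * (g : Γ ⧸ N x.1)⟩ else PMF.pure o, ?_, ?_⟩
  · rintro ⟨n, x⟩ ⟨m, y⟩ hxy
    by_cases hn : n₀ ≤ n
    · obtain rfl : m = n := hn₀ n hn x ⟨m, y⟩ hxy
      obtain ⟨k, hk, rfl⟩ := hBR m x y hxy
      simp only [hn, if_true]
      have h1 := tsum_abs_map_uniformOfFinset_sub_le hFne
        (fun g : Γ => (⟨m, x * (g : Γ ⧸ N m)⟩ : Σ n, Γ ⧸ N n)) k
      simp only [QuotientGroup.mk_mul, ← mul_assoc] at h1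
      refine h1.trans_lt ?_
      rw [div_lt_iff₀ (by exact_mod_cast hFne.card_pos)]
      have h2 := hFB k hk
      rw [Set.ncard_coe_finset] at h2
      have h3 : ((k • F) ∆ F).card = ((k • (F : Set Γ)) ∆ (F : Set Γ)).ncard := by
        rw [← Set.ncard_coe_finset]
        simp
      rwa [h3]
    · have hm : ¬ n₀ ≤ m := by
        intro hm
        have hnm : n = m := hn₀ m hm y ⟨n, x⟩ (by rwa [dist_comm])
        exact hn (hnm ▸ hm)
      simpa [hn, hm] using hε
  · rintro ⟨n, x⟩ z hz
    by_cases hn : n₀ ≤ n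
    · simp only [hn, if_true, PMF.mem_support_map_iff] at hz
      obtain ⟨g, hg, rfl⟩ := hz
      rw [PMF.mem_support_uniformOfFinset_iff] at hg
      rw [Metric.mem_closedBall, dist_comm]
      exact (hLF g hg n x).trans (le_max_left _ _)
    · simp only [hn, if_false, PMF.mem_support_pure_iff] at hz
      rw [hz, Metric.mem_closedBall]
      exact (hM ⟨⟨n, x⟩, not_le.1 hn, rfl⟩).trans (le_max_right _ _)

/-- Følner sets of uniformly bounded diameter in the quotients lift to Følner sets of the
group. -/
theorem IsBoxSpace.isAmenable (hX : IsBoxSpace S N)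
    (h : ∀ (K : Set Γ) (ε : ℝ), K.Finite → 0 < ε → ∃ L : ℝ, ∀ᶠ n in atTop,
      ∃ E : Set (Γ ⧸ N n), E.Nonempty ∧
        (∀ x ∈ E, ∀ y ∈ E, dist (⟨n, x⟩ : Σ n, Γ ⧸ N n) ⟨n, y⟩ ≤ L) ∧
        ∀ k ∈ K, ({x ∈ E | x * (k : Γ ⧸ N n) ∉ E}.ncard : ℝ) ≤ ε * E.ncard) :
    IsAmenable Γ := by
  intro K ε hK hε
  -- Both k and k⁻¹ are needed for the two halves of the symmetric difference, at a total cost of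
  -- 2ε/3.
  obtain ⟨L, hL⟩ := h (K ∪ K⁻¹) (ε / 3) (hK.union hK.inv) (by positivity)
  obtain ⟨B, hB, hBL⟩ := hX.exists_finite_of_dist_le L
  -- Injectivity must also cover translates gk: only then does a translate whose image lands in E
  -- belong to the lift F.
  have hBK : (B ∪ B * (K ∪ K⁻¹)).Finite := hB.union (hB.mul (hK.union hK.inv))
  obtain ⟨n, ⟨E, ⟨e, he⟩, hEd, hEK⟩, hinj⟩ := (hL.and (hX.eventually_injOn hBK)).exists
  have : Finite (Γ ⧸ N n) := hX.isSpaceOfGraphs.finite n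
  set F : Set Γ := {g ∈ B | e * (g : Γ ⧸ N n) ∈ E} with hF
  have hFfin : F.Finite := hB.subset fun g hg => hg.1
  have hinjF : Set.InjOn (fun g : Γ => e * (g : Γ ⧸ N n)) F := fun g hg g' hg' heq =>
    hinj (Or.inl hg.1) (Or.inl hg'.1) (mul_left_cancel heq)
  have himage : (fun g : Γ => e * (g : Γ ⧸ N n)) '' F = E := by
    ext x
    constructor
    · rintro ⟨g, hg, rfl⟩
      exact hg.2
    · intro hx
      obtain ⟨g, hg, rfl⟩ := hBL n e x (hEd e he x hx)
      exact ⟨g, ⟨hg, hx⟩, rfl⟩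
  have hcard : F.ncard = E.ncard := by rw [← himage, hinjF.ncard_image]
  have hFne : F.Nonempty := by
    rw [← Set.image_nonempty, himage]
    exact ⟨e, he⟩
  have hD : ∀ k ∈ K ∪ K⁻¹, ({g ∈ F | g * k ∉ F}.ncard : ℝ) ≤ ε / 3 * F.ncard := by
    intro k hk
    rw [hcard]
    refine le_trans ?_ (hEK k hk)
    rw [Nat.cast_le]
    refine Set.ncard_le_ncard_of_injOn (fun g : Γ => e * (g : Γ ⧸ N n)) ?_
      (hinjF.mono fun g hg => hg.1) (Set.toFinite _)
    rintro g ⟨hg, hgk⟩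
    refine ⟨hg.2, fun hmem => hgk ?_⟩
    rw [mul_assoc, ← QuotientGroup.mk_mul, ← himage] at hmem
    obtain ⟨g', hg', heq⟩ := hmem
    have : g' = g * k := hinj (Or.inl hg'.1) (Or.inr (Set.mul_mem_mul hg.1 hk))
      (mul_left_cancel heq)
    rwa [← this]
  have hFpos : (0 : ℝ) < F.ncard := by
    exact_mod_cast (Set.ncard_pos hFfin).2 hFne
  -- F is almost invariant on the right; inversion exchanges the sides.
  refine ⟨F⁻¹, hFfin.inv, hFne.inv, fun k hk => ?_⟩
  have h1 : ((k • F⁻¹) \ F⁻¹).ncard ≤ {g ∈ F | g * k⁻¹ ∉ F}.ncard := by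
    refine Set.ncard_le_ncard_of_injOn (fun x => x⁻¹ * k) ?_
      (fun x _ y _ hxy => inv_injective (mul_right_cancel hxy)) (hFfin.subset fun g hg => hg.1)
    rintro x ⟨hx, hx'⟩
    rw [Set.mem_smul_set_iff_inv_smul_mem, Set.mem_inv, smul_eq_mul, mul_inv_rev, inv_inv] at hx
    exact ⟨hx, by simpa using hx'⟩
  have h2 : (F⁻¹ \ (k • F⁻¹)).ncard ≤ {g ∈ F | g * k ∉ F}.ncard := by
    refine Set.ncard_le_ncard_of_injOn (fun x => x⁻¹) ?_
      (fun x _ y _ hxy => inv_injective hxy) (hFfin.subset fun g hg => hg.1)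
    rintro x ⟨hx, hx'⟩
    rw [Set.mem_smul_set_iff_inv_smul_mem, Set.mem_inv, smul_eq_mul, mul_inv_rev, inv_inv] at hx'
    exact ⟨hx, hx'⟩
  have h3 : ((k • F⁻¹) ∆ F⁻¹).ncard ≤ ((k • F⁻¹) \ F⁻¹).ncard + (F⁻¹ \ (k • F⁻¹)).ncard :=
    Set.ncard_union_le _ _
  have h4 := hD k⁻¹ (Or.inr (Set.inv_mem_inv.2 hk))
  have h5 := hD k (Or.inl hk)
  have h6 : (((k • F⁻¹) ∆ F⁻¹).ncard : ℝ)
      ≤ {g ∈ F | g * k⁻¹ ∉ F}.ncard + {g ∈ F | g * k ∉ F}.ncard := by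
    exact_mod_cast h3.trans (add_le_add h1 h2)
  have h7 : (F⁻¹).ncard = F.ncard := by
    rw [← Set.image_inv_eq_inv, Set.ncard_image_of_injective _ inv_injective]
  rw [h7]
  nlinarith

/-- The test set is a whole component. A point of A there which k moves out of A lands in the
R-boundary of A within the component, so the boundary estimate bounds the number of such points. -/
theorem ULA.isAmenable (hX : IsBoxSpace S N) (h : ULA (Σ n, Γ ⧸ N n)) : IsAmenable Γ := by
  refine hX.isAmenable fun K ε hK hε => ?_
  obtain ⟨R, hR, hRK⟩ := hX.exists_forall_dist_mul_le hK
  obtain ⟨L, hL, h⟩ := h R ε hR hε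
  refine ⟨L, ?_⟩
  filter_upwards [hX.eventually_fst_eq L] with n hn
  have : Finite (Γ ⧸ N n) := hX.isSpaceOfGraphs.finite n
  set X : Set (Σ n, Γ ⧸ N n) := Set.range (Sigma.mk (β := fun n => Γ ⧸ N n) n) with hXdef
  obtain ⟨A, hA, hAd, hlt⟩ := h X (Set.finite_range _) (Set.range_nonempty _)
  have hpos : 0 < (A ∩ X).ncard := by
    by_contra! h0
    rw [Nat.le_zero.1 h0, Nat.cast_zero, mul_zero] at hlt
    exact absurd hlt (not_lt.2 (Nat.cast_nonneg _))
  obtain ⟨_, heA, e, rfl⟩ := Set.nonempty_of_ncard_ne_zero hpos.ne'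
  have hdist : ∀ x ∈ A, ∀ y ∈ A, dist x y ≤ L := fun x hx y hy =>
    (edist_le_ofReal hL.le).1 ((Metric.edist_le_ediam_of_mem hx hy).trans hAd)
  have hinj : Function.Injective (Sigma.mk (β := fun n => Γ ⧸ N n) n) := sigma_mk_injective
  refine ⟨Sigma.mk (β := fun n => Γ ⧸ N n) n ⁻¹' A, ⟨e, heA⟩, fun x hx y hy => hdist _ hx _ hy, fun k hk => ?_⟩
  have hcard : (Sigma.mk (β := fun n => Γ ⧸ N n) n ⁻¹' A).ncard = (A ∩ X).ncard := by
    rw [hXdef, ← Set.image_preimage_eq_inter_range, Set.ncard_image_of_injective _ hinj]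
  rw [hcard]
  refine le_trans ?_ hlt.le
  rw [Nat.cast_le]
  refine Set.ncard_le_ncard_of_injOn (fun x => (⟨n, x * (k : Γ ⧸ N n)⟩ : Σ n, Γ ⧸ N n)) ?_
    (fun x _ y _ hxy => mul_right_cancel (hinj hxy)) ((Set.finite_range _).inter_of_right _)
  rintro x ⟨hx, hxk⟩
  refine ⟨⟨?_, hxk⟩, Set.mem_range_self _⟩
  refine Metric.mem_cthickening_of_dist_le _ ⟨n, x⟩ R A hx ?_
  rw [dist_comm]
  exact hRK k hk n x

end Amenability

/-! ### From averages of isometries to Følner sets -/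

section AlmostInvariant

variable {E : Type*} [NormedAddCommGroup E] [InnerProductSpace ℂ E]

/-- If each of the m applications shrank the norm by the factor q, the result would have norm at
most q^m < c. -/
theorem exists_iterate_norm_ge (T : E →L[ℂ] E) {φ : E} (hφ : ‖φ‖ = 1) {q c : ℝ} (hq : 0 ≤ q)
    {m : ℕ} (hqm : q ^ m < c) (hc : c ≤ ‖(T ^ m) φ‖) :
    ∃ j < m, (T ^ j) φ ≠ 0 ∧ q * ‖(T ^ j) φ‖ ≤ ‖T ((T ^ j) φ)‖ := by
  by_contra! hcon
  have h : ∀ j ≤ m, ‖(T ^ j) φ‖ ≤ q ^ j := by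
    intro j
    induction j with
    | zero => intro _; simp [hφ]
    | succ j ih =>
      intro hj
      have ih := ih (by omega)
      rw [pow_succ', mul_apply_eq_comp, pow_succ']
      by_cases h0 : (T ^ j) φ = 0
      · rw [h0, map_zero, norm_zero]
        positivity
      · exact (hcon j (by omega) h0).le.trans (mul_le_mul_of_nonneg_left ih hq)
  linarith [h m le_rfl]

variable {ι : Type*} [Fintype ι]

/-- The average of a finite family of isometries. -/
def average (U : ι → E →ₗᵢ[ℂ] E) : E →L[ℂ] E :=
  (Fintype.card ι : ℂ)⁻¹ • ∑ i, (U i).toContinuousLinearMap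

theorem average_apply (U : ι → E →ₗᵢ[ℂ] E) (ψ : E) :
    average U ψ = (Fintype.card ι : ℂ)⁻¹ • ∑ i, U i ψ := by
  simp [average]

theorem sum_norm_sub_average_sq [Nonempty ι] (U : ι → E →ₗᵢ[ℂ] E) (ψ : E) :
    ∑ i, ‖U i ψ - average U ψ‖ ^ 2 = Fintype.card ι * (‖ψ‖ ^ 2 - ‖average U ψ‖ ^ 2) := by
  have hsum : ∑ i, U i ψ = (Fintype.card ι : ℂ) • average U ψ := by
    rw [average_apply, smul_smul, mul_inv_cancel₀ (by exact_mod_cast Fintype.card_ne_zero),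
      one_smul]
  simp only [@norm_sub_sq ℂ, LinearIsometry.norm_map]
  rw [Finset.sum_add_distrib, Finset.sum_sub_distrib, ← Finset.mul_sum, ← map_sum, ← sum_inner,
    hsum, inner_smul_left]
  simp only [Finset.sum_const, Finset.card_univ, nsmul_eq_mul, Complex.conj_natCast,
    inner_self_eq_norm_sq_to_K]
  have : RCLike.re ((Fintype.card ι : ℂ) * (‖average U ψ‖ : ℂ) ^ 2)
      = Fintype.card ι * ‖average U ψ‖ ^ 2 := by
    have h : (Fintype.card ι : ℂ) * (‖average U ψ‖ : ℂ) ^ 2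
        = ((Fintype.card ι * ‖average U ψ‖ ^ 2 : ℝ) : ℂ) := by push_cast; rfl
    rw [h]
    exact Complex.ofReal_re _
  erw [this]
  ring

/-- By the variance identity `sum_norm_sub_average_sq`, an average almost as long as ψ forces every
U i ψ to be close to it. -/
theorem norm_sub_le_of_norm_average_ge [Nonempty ι] (U : ι → E →ₗᵢ[ℂ] E) {ψ : E} {q η : ℝ}
    (hq : 0 ≤ q) (hη : 0 ≤ η) (hqη : Fintype.card ι * (1 - q ^ 2) ≤ (η / 2) ^ 2)
    (h : q * ‖ψ‖ ≤ ‖average U ψ‖) (i j : ι) : ‖U i ψ - U j ψ‖ ≤ η * ‖ψ‖ := by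
  have key : ∀ i, ‖U i ψ - average U ψ‖ ≤ η / 2 * ‖ψ‖ := by
    intro i
    refine le_of_sq_le_sq ?_ (by positivity)
    calc ‖U i ψ - average U ψ‖ ^ 2 ≤ ∑ i, ‖U i ψ - average U ψ‖ ^ 2 :=
          Finset.single_le_sum (f := fun i => ‖U i ψ - average U ψ‖ ^ 2)
            (fun _ _ => by positivity) (Finset.mem_univ i)
      _ = Fintype.card ι * (‖ψ‖ ^ 2 - ‖average U ψ‖ ^ 2) := sum_norm_sub_average_sq U ψ
      _ ≤ Fintype.card ι * (‖ψ‖ ^ 2 - (q * ‖ψ‖) ^ 2) := by gcongr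
      _ = Fintype.card ι * (1 - q ^ 2) * ‖ψ‖ ^ 2 := by ring
      _ ≤ (η / 2) ^ 2 * ‖ψ‖ ^ 2 := by gcongr
      _ = (η / 2 * ‖ψ‖) ^ 2 := by ring
  have := norm_sub_le_norm_sub_add_norm_sub (U i ψ) (average U ψ) (U j ψ)
  rw [norm_sub_rev (average U ψ)] at this
  linarith [key i, key j]

end AlmostInvariant

/-- Namioka's trick: f = |ψ|² is almost invariant in ℓ¹ because ψ is so in ℓ², and some superlevel
set of f inherits this. -/
theorem exists_folner_of_almost_invariant {G κ H : Type*} [Group G] [Fintype G] [Fintype κ]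
    [NormedAddCommGroup H] (g : κ → G) {ψ : G → H} (hψ : ψ ≠ 0) {ε : ℝ} (hε : 0 < ε)
    (h : ∀ k, ∑ x, ‖ψ (x * g k) - ψ x‖ ^ 2
      ≤ (ε / (3 * (Fintype.card κ + 1))) ^ 2 * ∑ x, ‖ψ x‖ ^ 2) :
    ∃ E : Set G, E.Nonempty ∧ (∀ x ∈ E, ψ x ≠ 0) ∧
      ∀ k, ({x ∈ E | x * g k ∉ E}.ncard : ℝ) ≤ ε * E.ncard := by
  set η := ε / (3 * (Fintype.card κ + 1)) with hη
  have hηpos : 0 < η := by positivity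
  set f : G → ℝ := fun x => ‖ψ x‖ ^ 2 with hf
  have hfpos : 0 < ∑ x, f x := by
    obtain ⟨x, hx⟩ := Function.ne_iff.1 hψ
    exact Finset.sum_pos' (fun _ _ => by positivity)
      ⟨x, Finset.mem_univ _, by have := norm_pos_iff.2 hx; positivity⟩
  have hpoint : ∀ k x, max (f x - f (x * g k)) 0
      ≤ ‖ψ (x * g k) - ψ x‖ ^ 2 / (2 * η) + η * (f x + f (x * g k)) := by
    intro k x
    refine max_le ?_ (by positivity)
    set a := ‖ψ x‖
    set b := ‖ψ (x * g k)‖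
    set d := ‖ψ (x * g k) - ψ x‖
    have hab : a - b ≤ d := by
      have := norm_sub_norm_le (ψ x) (ψ (x * g k))
      rwa [norm_sub_rev] at this
    have h1 : (a - b) * (a + b) ≤ d * (a + b) := by gcongr
    -- A weighted AM-GM inequality; after summation its two terms contribute η/2 and 2η.
    have h2 : d * (a + b) ≤ d ^ 2 / (2 * η) + η * (a ^ 2 + b ^ 2) := by
      rw [← sub_nonneg]
      have : d ^ 2 / (2 * η) + η * (a ^ 2 + b ^ 2) - d * (a + b)
          = ((d - η * (a + b)) ^ 2 + η ^ 2 * (a - b) ^ 2) / (2 * η) := by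
        field_simp
        ring
      rw [this]
      positivity
    calc f x - f (x * g k) = (a - b) * (a + b) := by simp only [hf]; ring
      _ ≤ _ := h1.trans h2
  have hk : ∀ k, ∑ x, max (f x - f (x * g k)) 0 ≤ 5 / 2 * η * ∑ x, f x := by
    intro k
    have htrans : ∑ x, f (x * g k) = ∑ x, f x := Equiv.sum_comp (Equiv.mulRight (g k)) f
    calc ∑ x, max (f x - f (x * g k)) 0
        ≤ ∑ x, (‖ψ (x * g k) - ψ x‖ ^ 2 / (2 * η) + η * (f x + f (x * g k))) :=
          Finset.sum_le_sum fun x _ => hpoint k x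
      _ = (∑ x, ‖ψ (x * g k) - ψ x‖ ^ 2) / (2 * η) + 2 * η * ∑ x, f x := by
          rw [Finset.sum_add_distrib, ← Finset.sum_div, ← Finset.mul_sum,
            Finset.sum_add_distrib, htrans]
          ring
      _ ≤ (η ^ 2 * ∑ x, f x) / (2 * η) + 2 * η * ∑ x, f x := by
          gcongr
          exact h k
      _ = 5 / 2 * η * ∑ x, f x := by
          field_simp
          ring
  have htotal : ∑ p : κ × G, max (f p.2 - f (p.2 * g p.1)) 0 < ε * ∑ x, f x := by
    rw [Fintype.sum_prod_type]
    calc ∑ k, ∑ x, max (f x - f (x * g k)) 0 ≤ ∑ _k : κ, 5 / 2 * η * ∑ x, f x :=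
          Finset.sum_le_sum fun k _ => hk k
      _ = (Fintype.card κ * (5 / 2 * η)) * ∑ x, f x := by
          rw [Finset.sum_const, Finset.card_univ, nsmul_eq_mul, ← mul_assoc]
      _ < ε * ∑ x, f x := by
          gcongr
          rw [hη]
          have : (Fintype.card κ : ℝ) * (5 / 2 * (ε / (3 * (Fintype.card κ + 1))))
              = ε * (5 / 6 * (Fintype.card κ / (Fintype.card κ + 1))) := by
            field_simp
            ring
          rw [this]
          have h1 : (Fintype.card κ : ℝ) / (Fintype.card κ + 1) ≤ 1 :=
            (div_le_one (by positivity)).2 (by linarith)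
          nlinarith
  -- Indexing by κ × G makes a single level t serve all k at once.
  obtain ⟨t, ht, hlt⟩ := exists_level_lt (fun _ : κ × G => 1) (fun p => f p.2)
    (fun p => f (p.2 * g p.1)) (fun _ : G => ENNReal.ofReal ε) f (by
      have hl : ∀ p : κ × G, 1 * ENNReal.ofReal (f p.2 - f (p.2 * g p.1))
          = ENNReal.ofReal (max (f p.2 - f (p.2 * g p.1)) 0) := by
        intro p
        rw [one_mul, ENNReal.ofReal_max, ENNReal.ofReal_zero]
        exact (max_eq_left zero_le).symm
      have hr : ∑ x, ENNReal.ofReal ε * ENNReal.ofReal (f x)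
          = ENNReal.ofReal (ε * ∑ x, f x) := by
        rw [← Finset.mul_sum, ← ENNReal.ofReal_sum_of_nonneg fun x _ => by positivity,
          ← ENNReal.ofReal_mul hε.le]
      rw [tsum_fintype, tsum_fintype, hr]
      simp only [hl]
      rw [← ENNReal.ofReal_sum_of_nonneg fun _ _ => le_max_right _ _]
      exact (ENNReal.ofReal_lt_ofReal_iff (by positivity)).2 htotal)
  set E : Set G := {x | t < f x} with hE
  have hright : ∑' x, ENNReal.ofReal ε * (Set.Ico 0 (f x)).indicator 1 t
      = ENNReal.ofReal (ε * E.ncard) := by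
    rw [ENNReal.tsum_mul_left, ENNReal.ofReal_mul hε.le, ENNReal.ofReal_natCast]
    congr 1
    have : ∀ x, (Set.Ico 0 (f x)).indicator (1 : ℝ → ℝ≥0∞) t = E.indicator 1 x := by
      intro x
      by_cases hx : t < f x
      · rw [Set.indicator_of_mem (show t ∈ Set.Ico 0 (f x) from ⟨ht, hx⟩),
          Set.indicator_of_mem (show x ∈ E from hx)]
        rfl
      · rw [Set.indicator_of_notMem fun h => hx h.2,
          Set.indicator_of_notMem (show x ∉ E from hx)]
    simp only [this]
    rw [tsum_indicator_one, ← Set.Finite.cast_ncard_eq (Set.toFinite E)]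
    rfl
  rw [hright] at hlt
  refine ⟨E, ?_, fun x hx h0 => ?_, fun k => ?_⟩
  · by_contra hemp
    rw [Set.not_nonempty_iff_eq_empty.1 hemp] at hlt
    simp at hlt
  · have : t < ‖ψ x‖ ^ 2 := hx
    rw [h0] at this
    simp only [norm_zero, ne_eq, OfNat.ofNat_ne_zero, not_false_eq_true, zero_pow] at this
    linarith
  · have hle : ENNReal.ofReal ({x ∈ E | x * g k ∉ E}.ncard) ≤ ENNReal.ofReal (ε * E.ncard) := by
      refine le_trans ?_ hlt.le
      rw [ENNReal.tsum_prod']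
      refine le_trans ?_ (ENNReal.le_tsum k)
      have : ENNReal.ofReal ({x ∈ E | x * g k ∉ E}.ncard)
          = (({x ∈ E | x * g k ∉ E}.encard : ℕ∞) : ℝ≥0∞) := by
        rw [ENNReal.ofReal_natCast, ← Set.Finite.cast_ncard_eq (Set.toFinite _)]
        rfl
      rw [this, ← tsum_indicator_one]
      refine ENNReal.tsum_le_tsum fun x => ?_
      by_cases hx : x ∈ {x ∈ E | x * g k ∉ E}
      · rw [Set.indicator_of_mem hx, Set.indicator_of_mem
          (show t ∈ Set.Ico (f (x * g k)) (f x) from ⟨not_lt.1 hx.2, hx.1⟩)]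
        simp
      · rw [Set.indicator_of_notMem hx]
        exact zero_le
    exact (ENNReal.ofReal_le_ofReal_iff (by positivity)).1 hle

/-! ### Translation operators on a component -/

section Translation

variable {G : ℕ → Type*} [∀ n, Group (G n)]

/-- Right translation by `g n` on the component `G n`. -/
def translate (g : ∀ n, G n) (x : Σ n, G n) : Σ n, G n := ⟨x.1, x.2 * g x.1⟩

variable [∀ n, Fintype (G n)]

/-- The uniform probability measure on the component `G n`. -/
def componentPMF (G : ℕ → Type*) [∀ n, Group (G n)] [∀ n, Fintype (G n)] (n : ℕ) :
    PMF (Σ n, G n) :=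
  PMF.uniformOfFinset (Finset.univ.map ⟨Sigma.mk n, sigma_mk_injective⟩)
    ((Finset.map_nonempty).2 Finset.univ_nonempty)

theorem mem_support_componentPMF {n : ℕ} {x : Σ n, G n} :
    x ∈ (componentPMF G n).support ↔ x.1 = n := by
  rw [componentPMF, PMF.mem_support_uniformOfFinset_iff, Finset.mem_map]
  constructor
  · rintro ⟨y, -, rfl⟩
    rfl
  · rintro rfl
    exact ⟨x.2, Finset.mem_univ _, rfl⟩

theorem componentPMF_mk (n : ℕ) (x : G n) :
    componentPMF G n ⟨n, x⟩ = (Fintype.card (G n) : ℝ≥0∞)⁻¹ := by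
  classical
  rw [componentPMF, PMF.uniformOfFinset_apply_of_mem]
  · simp
  · exact Finset.mem_map_of_mem _ (Finset.mem_univ _)

theorem componentPMF_translate (g : ∀ n, G n) (n : ℕ) (x : Σ n, G n) :
    componentPMF G n (translate g x) = componentPMF G n x := by
  by_cases hx : x.1 = n
  · obtain ⟨m, x⟩ := x
    obtain rfl : m = n := hx
    rw [translate, componentPMF_mk, componentPMF_mk]
  · have h0 : ∀ y : Σ n, G n, y.1 ≠ n → componentPMF G n y = 0 := fun y hy =>
      (PMF.apply_eq_zero_iff _ _).2 fun h => hy (mem_support_componentPMF.1 h)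
    rw [h0 x hx, h0 (translate g x) hx]

theorem translate_mem_support (g : ∀ n, G n) {n : ℕ} {x : Σ n, G n}
    (hx : x ∈ (componentPMF G n).support) : translate g x ∈ (componentPMF G n).support := by
  rw [mem_support_componentPMF] at hx ⊢
  exact hx

theorem measurePreserving_translate (g : ∀ n, G n) (n : ℕ) :
    @MeasurePreserving _ _ ⊤ ⊤ (translate g) (discreteMeasure (componentPMF G n))
      (discreteMeasure (componentPMF G n)) := by
  let _ : MeasurableSpace (Σ n, G n) := ⊤
  refine ⟨measurable_from_top, Measure.ext_of_singleton fun x => ?_⟩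
  rw [Measure.map_apply measurable_from_top (measurableSet_singleton x)]
  have : translate g ⁻¹' {x} = {translate (fun n => (g n)⁻¹) x} := by
    ext y
    simp only [Set.mem_preimage, Set.mem_singleton_iff, translate]
    constructor
    · rintro rfl
      simp
    · rintro rfl
      simp
  rw [this, discreteMeasure_singleton, discreteMeasure_singleton, componentPMF_translate]

/-- The isometry of `l²(G n)` given by right translation. -/
def translateIsometry (n : ℕ) (g : ∀ n, G n) :
    WeightedL2 (componentPMF G n) ℂ →ₗᵢ[ℂ] WeightedL2 (componentPMF G n) ℂ :=
  letI : MeasurableSpace (Σ n, G n) := ⊤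
  Lp.compMeasurePreservingₗᵢ ℂ (translate g) (measurePreserving_translate g n)

theorem translateIsometry_apply {n : ℕ} (g : ∀ n, G n) (φ : WeightedL2 (componentPMF G n) ℂ)
    {x : Σ n, G n} (hx : x ∈ (componentPMF G n).support) :
    translateIsometry n g φ x = φ (translate g x) :=
  letI : MeasurableSpace (Σ n, G n) := ⊤
  forall_of_ae (Lp.coeFn_compMeasurePreserving φ (measurePreserving_translate g n)) x hx

theorem norm_sq_componentPMF {n : ℕ} (φ : WeightedL2 (componentPMF G n) ℂ) :
    ‖φ‖ ^ 2 = (Fintype.card (G n) : ℝ)⁻¹ * ∑ x : G n, ‖φ ⟨n, x⟩‖ ^ 2 := by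
  have h : ‖φ‖ₑ ^ 2 = (Fintype.card (G n) : ℝ≥0∞)⁻¹ * ∑ x : G n, ‖φ ⟨n, x⟩‖ₑ ^ 2 := by
    rw [WeightedL2.enorm_sq, ENNReal.tsum_sigma', tsum_eq_single n, tsum_fintype, Finset.mul_sum]
    · simp only [componentPMF_mk]
    · intro m hm
      refine ENNReal.tsum_eq_zero.2 fun x => ?_
      rw [(PMF.apply_eq_zero_iff _ _).2 fun h => hm (mem_support_componentPMF.1 h), zero_mul]
  have h' := congrArg ENNReal.toReal h
  rw [ENNReal.toReal_mul, ENNReal.toReal_sum (by simp)] at h'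
  simpa using h'

variable {κ : Type*} [Fintype κ]

/-- The average of the translations by a finite family. -/
abbrev translateAverage (n : ℕ) (g : κ → ∀ n, G n) :
    WeightedL2 (componentPMF G n) ℂ →L[ℂ] WeightedL2 (componentPMF G n) ℂ :=
  average fun k => translateIsometry n (g k)

theorem translateAverage_apply {n : ℕ} (g : κ → ∀ n, G n) (φ : WeightedL2 (componentPMF G n) ℂ)
    {x : Σ n, G n} (hx : x ∈ (componentPMF G n).support) :
    translateAverage n g φ x = (Fintype.card κ : ℂ)⁻¹ * ∑ k, φ (translate (g k) x) := by
  rw [average_apply, ← WeightedL2.eval_apply x hx, map_smul, map_sum, smul_eq_mul]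
  simp only [WeightedL2.eval_apply, translateIsometry_apply _ _ hx]

theorem one_le_norm_translateAverage_pow [Nonempty κ] (n : ℕ) (g : κ → ∀ n, G n) (m : ℕ) :
    1 ≤ ‖translateAverage n g ^ m‖ := by
  let _ : MeasurableSpace (Σ n, G n) := ⊤
  set e : WeightedL2 (componentPMF G n) ℂ := indicatorConstLp 2 (s := Set.univ)
    (μ := discreteMeasure (componentPMF G n)) MeasurableSet.univ (measure_ne_top _ _) 1 with he
  have he1 : ∀ x ∈ (componentPMF G n).support, e x = 1 := fun x hx => by
    rw [forall_of_ae (indicatorConstLp_coeFn (μ := discreteMeasure (componentPMF G n))) x hx]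
    simp
  have hTe : translateAverage n g e = e := by
    refine WeightedL2.ext fun x hx => ?_
    rw [translateAverage_apply g e hx, he1 x hx]
    have : ∀ k, e (translate (g k) x) = 1 := fun k =>
      he1 _ (translate_mem_support (g k) hx)
    simp only [this, Finset.sum_const, Finset.card_univ, nsmul_eq_mul, mul_one]
    exact inv_mul_cancel₀ (by exact_mod_cast Fintype.card_ne_zero)
  have hpow : (translateAverage n g ^ m) e = e := by
    induction m with
    | zero => simp
    | succ m ih => rw [pow_succ, mul_apply_eq_comp, hTe, ih]
  have hne : 0 < ‖e‖ := by
    rw [norm_pos_iff]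
    intro h0
    have hx : (⟨n, 1⟩ : Σ n, G n) ∈ (componentPMF G n).support := mem_support_componentPMF.2 rfl
    have h1 := he1 _ hx
    rw [h0, ← WeightedL2.eval_apply _ hx, map_zero] at h1
    exact zero_ne_one h1
  have := (translateAverage n g ^ m).le_opNorm e
  rw [hpow] at this
  exact (le_mul_iff_one_le_left hne).1 this

variable [MetricSpace (Σ n, G n)]

theorem supp_translateAverage_pow_subset {n : ℕ} {g : κ → ∀ n, G n} {L : ℝ} (hL : 0 ≤ L)
    (hg : ∀ k x, dist x (translate (g k) x) ≤ L) (φ : WeightedL2 (componentPMF G n) ℂ) (m : ℕ) :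
    supp ((translateAverage n g ^ m) φ) ⊆ Metric.cthickening (m * L) (supp φ) := by
  induction m with
  | zero => simpa using subset_closure
  | succ m ih =>
    rw [pow_succ', mul_apply_eq_comp]
    set ψ := (translateAverage n g ^ m) φ
    have hstep : supp (translateAverage n g ψ) ⊆ Metric.cthickening L (supp ψ) := by
      rintro x ⟨hx, h⟩
      rw [translateAverage_apply g ψ hx] at h
      obtain ⟨k, -, hk⟩ := Finset.exists_ne_zero_of_sum_ne_zero (right_ne_zero_of_mul h)
      exact Metric.mem_cthickening_of_dist_le _ (translate (g k) x) _ _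
        ⟨translate_mem_support (g k) hx, hk⟩ (hg k x)
    have := (hstep.trans (Metric.cthickening_subset_of_subset L ih)).trans
      (Metric.cthickening_cthickening_subset hL (by positivity : 0 ≤ (m : ℝ) * L) (supp φ))
    rwa [show L + m * L = ((m + 1 : ℕ) : ℝ) * L by push_cast; ring] at this

theorem hasPropagation_translateAverage_pow {n : ℕ} {g : κ → ∀ n, G n} {L : ℝ} (hL : 0 ≤ L)
    (hg : ∀ k x, dist x (translate (g k) x) ≤ L) (m : ℕ) :
    HasPropagation (m * L) (translateAverage n g ^ m) := by
  intro x hx y hy hxy v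
  by_contra hne
  have hsupp : supp (single (componentPMF G n) y v) ⊆ {y} := by
    rintro z ⟨hz, h⟩
    rw [single_apply _ _ hz] at h
    exact Set.mem_of_indicator_ne_zero h
  have h1 := Metric.cthickening_subset_of_subset _ hsupp
    (supp_translateAverage_pow_subset hL hg (single (componentPMF G n) y v) m ⟨hx, hne⟩)
  rw [Metric.cthickening_singleton y (by positivity)] at h1
  exact absurd h1 (not_le.2 hxy)

end Translation

/-! ### `ONL` implies amenability -/

theorem exists_contraction_constant (d : ℕ) {η : ℝ} (hη : 0 < η) :
    ∃ q : ℝ, 0 ≤ q ∧ q < 1 ∧ d * (1 - q ^ 2) ≤ (η / 2) ^ 2 := by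
  have hlim : Tendsto (fun q : ℝ => d * (1 - q ^ 2)) (nhdsWithin 1 (Set.Iio 1)) (nhds 0) := by
    have h : Continuous fun q : ℝ => d * (1 - q ^ 2) := by fun_prop
    simpa using (h.tendsto 1).mono_left nhdsWithin_le_nhds
  have h1 : ∀ᶠ q in nhdsWithin (1 : ℝ) (Set.Iio 1), d * (1 - q ^ 2) < (η / 2) ^ 2 :=
    hlim.eventually_lt_const (by positivity)
  have h2 : ∀ᶠ q in nhdsWithin (1 : ℝ) (Set.Iio 1), q ∈ Set.Ico (0 : ℝ) 1 :=
    Ico_mem_nhdsLT zero_lt_one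
  obtain ⟨q, hq, hq'⟩ := (h1.and h2).exists
  exact ⟨q, hq'.1, hq'.2, hq.le⟩

variable {Γ : Type*} [Group Γ] {S : Finset Γ} {N : ℕ → Subgroup Γ} [∀ n, (N n).Normal]
  [MetricSpace (Σ n, Γ ⧸ N n)]

theorem ONL.isAmenable (hX : IsBoxSpace S N) (h : ONL (Σ n, Γ ⧸ N n)) : IsAmenable Γ := by
  obtain ⟨c, hc, h⟩ := h
  refine hX.isAmenable fun K ε hK hε => ?_
  have _ : ∀ n, Fintype (Γ ⧸ N n) := fun n =>
    have := hX.isSpaceOfGraphs.finite n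
    Fintype.ofFinite _
  -- With 1 among the translations, closeness of all translates of ψ to each other includes
  -- closeness to ψ itself.
  have hK' : (insert 1 K).Finite := hK.insert 1
  set κ := ↥(insert 1 K)
  have _ : Fintype κ := hK'.fintype
  have _ : Nonempty κ := ⟨⟨1, Set.mem_insert _ _⟩⟩
  set g : κ → ∀ n, Γ ⧸ N n := fun k n => ((k : Γ) : Γ ⧸ N n) with hg
  obtain ⟨L, hL, hLK⟩ := hX.exists_forall_dist_mul_le hK'
  have hgL : ∀ k x, dist x (translate (g k) x) ≤ L := fun k x => hLK k k.2 x.1 x.2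
  set η := ε / (3 * (Fintype.card κ + 1)) with hη
  have hηpos : 0 < η := by positivity
  obtain ⟨q, hq0, hq1, hqη⟩ := exists_contraction_constant (Fintype.card κ) hηpos
  -- The order matters: c comes before R in `ONL`, so m may depend on c and the propagation mL on m.
  obtain ⟨m, hm⟩ := exists_pow_lt_of_lt_one hc hq1
  have hm0 : (0 : ℝ) ≤ m * L := by positivity
  -- The extra 1 keeps the propagation positive even when m = 0.
  obtain ⟨D, hD, h⟩ := h (m * L + 1) (by positivity)
  refine ⟨D + 2 * (m * L), Eventually.of_forall fun n => ?_⟩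
  have hprop : HasPropagation (m * L + 1) (translateAverage n g ^ m) :=
    fun x hx y hy hxy v =>
      hasPropagation_translateAverage_pow hL.le hgL m x hx y hy (by linarith) v
  obtain ⟨φ, hφ, hφd, hφT⟩ := h (componentPMF (fun n => Γ ⧸ N n) n) ℂ _ hprop
  obtain ⟨j, hj, hψ0, hψ⟩ := exists_iterate_norm_ge (translateAverage n g) hφ hq0 hm
    ((le_mul_of_one_le_right hc.le (one_le_norm_translateAverage_pow n g m)).trans hφT)
  set ψ := (translateAverage n g ^ j) φ with hψdef
  have hinv : ∀ k, ‖translateIsometry n (g k) ψ - ψ‖ ≤ η * ‖ψ‖ := by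
    intro k
    have h1 := norm_sub_le_of_norm_average_ge (fun k => translateIsometry n (g k)) hq0 hηpos.le
      hqη hψ k ⟨1, Set.mem_insert _ _⟩
    have h2 : translateIsometry n (g ⟨1, Set.mem_insert _ _⟩) ψ = ψ := by
      refine WeightedL2.ext fun x hx => ?_
      rw [translateIsometry_apply _ _ hx]
      simp [translate, hg]
    rwa [h2] at h1
  have hmem : ∀ x : Γ ⧸ N n, (⟨n, x⟩ : Σ n, Γ ⧸ N n) ∈
      (componentPMF (fun n => Γ ⧸ N n) n).support := fun x => mem_support_componentPMF.2 rfl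
  have hcard : (0 : ℝ) < (Fintype.card (Γ ⧸ N n) : ℝ)⁻¹ := by
    have : 0 < Fintype.card (Γ ⧸ N n) := Fintype.card_pos
    positivity
  obtain ⟨E, hEne, hEψ, hEK⟩ := exists_folner_of_almost_invariant (fun k => g k n)
    (ψ := fun x : Γ ⧸ N n => ψ ⟨n, x⟩) (fun h0 => hψ0 <| by
      refine norm_eq_zero.1 (pow_eq_zero_iff two_ne_zero |>.1 ?_)
      rw [norm_sq_componentPMF]
      have : ∀ x : Γ ⧸ N n, ψ ⟨n, x⟩ = 0 := fun x => congrFun h0 x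
      simp [this]) hε (fun k => by
      have h1 : ‖translateIsometry n (g k) ψ - ψ‖ ^ 2 ≤ (η * ‖ψ‖) ^ 2 := by
        gcongr
        exact hinv k
      rw [mul_pow, norm_sq_componentPMF, norm_sq_componentPMF, mul_left_comm,
        mul_le_mul_iff_right₀ hcard] at h1
      refine le_trans (le_of_eq (Finset.sum_congr rfl fun x _ => ?_)) h1
      rw [← WeightedL2.eval_apply _ (hmem x) (_ - _), map_sub, WeightedL2.eval_apply,
        WeightedL2.eval_apply, translateIsometry_apply _ _ (hmem x)]
      rfl)
  refine ⟨E, hEne, fun x hx y hy => ?_, fun k hk => hEK ⟨k, Set.mem_insert_of_mem _ hk⟩⟩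
  -- E lies in the support of ψ = T^j φ, which exceeds that of φ by at most mL because j < m.
  have hd : Metric.ediam (supp ψ) ≤ ENNReal.ofReal (D + 2 * (m * L)) := by
    refine (Metric.ediam_mono (supp_translateAverage_pow_subset hL.le hgL φ j)).trans
      ((ediam_cthickening_le_ofReal (by positivity) hD.le hφd).trans
        (ENNReal.ofReal_le_ofReal ?_))
    have : (j : ℝ) ≤ m := by exact_mod_cast hj.le
    gcongr
  refine (edist_le_ofReal (by positivity)).1 ((Metric.edist_le_ediam_of_mem ?_ ?_).trans hd)
  · exact ⟨hmem x, hEψ x hx⟩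
  · exact ⟨hmem y, hEψ y hy⟩

end BoxSpaces

end

theorem mainTheorem7 {Γ : Type*} [Group Γ] (S : Finset Γ) (N : ℕ → Subgroup Γ)
    [∀ n, (N n).Normal] [MetricSpace (Σ n, Γ ⧸ N n)] (hX : BoxSpaces.IsBoxSpace S N) :
    List.TFAE [
      BoxSpaces.IsAmenable Γ,
      BoxSpaces.PropertyA (Σ n, Γ ⧸ N n) ∧ BoxSpaces.ULA (Σ n, Γ ⧸ N n) ∧
        BoxSpaces.ULAmu (Σ n, Γ ⧸ N n) ∧ BoxSpaces.MSP (Σ n, Γ ⧸ N n) ∧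
        BoxSpaces.ONL (Σ n, Γ ⧸ N n),
      BoxSpaces.PropertyA (Σ n, Γ ⧸ N n) ∨ BoxSpaces.ULA (Σ n, Γ ⧸ N n) ∨
        BoxSpaces.ULAmu (Σ n, Γ ⧸ N n) ∨ BoxSpaces.MSP (Σ n, Γ ⧸ N n) ∨
        BoxSpaces.ONL (Σ n, Γ ⧸ N n)] := by
  have hbg := hX.isSpaceOfGraphs.boundedGeometry
  have hfin : ∀ n, Finite (Γ ⧸ N n) := hX.isSpaceOfGraphs.finite
  tfae_have 1 → 2 := fun h =>
    have hA := h.propertyA hX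
    have hμ := hA.ulaMu hbg
    ⟨hA, hμ.ula, hμ, hμ.msp, hμ.msp.onl⟩
  tfae_have 2 → 3 := fun h => Or.inl h.1
  tfae_have 3 → 1 := by
    rintro (h | h | h | h | h)
    · exact (h.ulaMu hbg).ula.isAmenable hX
    · exact h.isAmenable hX
    · exact h.ula.isAmenable hX
    · exact (h.ulaMu hbg).ula.isAmenable hX
    · exact h.isAmenable hX
  tfae_finish
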